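/- **Notation.** $\mathbb N=\{1,2,\dots\}$, $\mathbb N_0=\mathbb N\cup\{0\}$. For $\mathbf L,\mathbf d\in\mathbb N$, $\mathbf l=(\mathbf l_0,\dots,\mathbf l_{\mathbf L})\in\mathbb N^{\mathbf L+1}$ with $\mathbf d\ge\sum_{i=1}^{\mathbf L}\mathbf l_i(\mathbf l_{i-1}+1)$, real $u<v$ and $\theta\in\mathbb R^{\mathbf d}$ let $\mathscr N^{\theta,\mathbf l}_{u,v}\colon\mathbb R^{\mathbf l_0}\to\mathbb R^{\mathbf l_{\mathbf L}}$ be the fully connected feedforward network $\mathbf a_{\mathbf L}\circ\mathscr A_{\mathbf L}\circ\mathbf a_{\mathbf L-1}\circ\dots\circ\mathbf a_1\circ\mathscr A_1$, where $\mathscr A_i\colon\mathbb R^{\mathbf l_{i-1}}\to\mathbb R^{\mathbf l_i}$ is the affine map whose weight matrix (row by row) followed by its bias vector is given by the $\mathbf l_i(\mathbf l_{i-1}+1)$ coordinates of $\theta$ after the first $\sum_{k=1}^{i-1}\mathbf l_k(\mathbf l_{k-1}+1)$ ones, $\mathbf a_i$ for $i<\mathbf L$ applies the rectifier $x\mapsto\max\{x,0\}$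 to each coordinate, and $\mathbf a_{\mathbf L}$ applies the clipping function $x\mapsto\max\{\min\{x,v\},u\}$ to each coordinate. Write $\|x\|_1=\sum_i|x_i|$, $\|x\|_\infty=\max_i|x_i|$. **Statement.** Let $d,\mathbf d,\mathbf L,M,K,N\in\mathbb N$, $p\in(0,\infty)$, $L\in[0,\infty)$, $a,u\in\mathbb R$, $v\in(u,\infty)$, $b\in(a,\infty)$, $c\in[\max\{1,2|u|,2|v|,|a|,|b|,L\},\infty)$, $\beta\in[c,\infty)$, $\mathbf l=(\mathbf l_0,\dots,\mathbf l_{\mathbf L})\in\mathbb N^{\mathbf L+1}$, $\mathfrak N\subseteq\{0,1,\dots,N\}$ satisfy $0\in\mathfrak N$, $\mathbf l_0=d$, $\mathbf l_{\mathbf L}=1$ and $\mathbf d\ge\sum_{i=1}^{\mathbf L}\mathbf l_i(\mathbf l_{i-1}+1)$. Let $(\Omega,\mathcal F,\mathbb P)$ be a probability space, let $(X_j,Y_j)\colon\Omega\to[a,b]^d\times[u,v]$, $j\in\{1,\dots,M\}$, be i.i.d. random variables, let $\mathcal E\colon[a,b]^d\to[u,v]$ satisfy $\mathcal E(X_1)=\mathbb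 E[Y_1|X_1]$ $\mathbb P$-a.s. and $|\mathcal E(x)-\mathcal E(y)|\le L\|x-y\|_1$ for all $x,y\in[a,b]^d$. Let $\Theta_{k,n}\colon\Omega\to\mathbb R^{\mathbf d}$, $k,n\in\mathbb N_0$, and $\mathbf k\colon\Omega\to(\mathbb N_0)^2$ be random variables such that $\Theta_{k,0}$, $k\in\{1,\dots,K\}$, are i.i.d. and $\Theta_{1,0}$ is uniformly distributed on $[-c,c]^{\mathbf d}$. Let $\mathcal R(\theta,\omega)=\frac1M\sum_{j=1}^M|\mathscr N^{\theta,\mathbf l}_{u,v}(X_j(\omega))-Y_j(\omega)|^2$ for $\theta\in\mathbb R^{\mathbf d}$, $\omega\in\Omega$, and assume for all $\omega\in\Omega$ that $$\mathbf k(\omega)\in\arg\min_{(k,n)\in\{1,\dots,K\}\times\mathfrak N,\ \|\Theta_{k,n}(\omega)\|_\infty\le\beta}\mathcal R(\Theta_{k,n}(\omega),\omega).$$ Put $A=\min\{2^{\mathbf L-1},\mathbf l_1,\dots,\mathbf l_{\mathbf L-1}\}$ (so $A=1$ if $\mathbf L=1$) and $W=\|\mathbf l\|_\infty+1$. Then the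 function $\omega\mapsto\int_{[a,b]^d}|\mathscr N^{\Theta_{\mathbf k(\omega)}(\omega),\mathbf l}_{u,v}(x)-\mathcal E(x)|^2\,\mathbb P_{X_1}(\mathrm dx)\in[0,\infty]$ is measurable and $$\begin{aligned} &\left(\mathbb E\left[\left(\int_{[a,b]^d}|\mathscr N^{\Theta_{\mathbf k},\mathbf l}_{u,v}(x)-\mathcal E(x)|^2\,\mathbb P_{X_1}(\mathrm dx)\right)^{p/2}\right]\right)^{1/p}\\ &\le\frac{3dL(b-a)}{A^{1/d}}+\frac{2\left[(v-u)\,\mathbf L\,W^{\mathbf L}c^{\mathbf L+1}\max\{p/2,1\}\right]^{1/2}}{K^{(2\mathbf L)^{-1}W^{-2}}}+\frac{\max\{v-u,1\}\left[10\,\mathbf L\,W^{3/2}\max\{p/2,\ln(4M\beta c)\}\right]^{1/2}}{M^{1/4}}\\ &\le\frac{6dc^2}{A^{1/d}}+\frac{2\left[\mathbf L\,W^{\mathbf L}c^{\mathbf L+2}\max\{p,1\}\right]^{1/2}}{K^{(2\mathbf L)^{-1}W^{-2}}}+\frac{4c\,\beta^{1/2}\mathbf L^{1/2}W^{3/4}\max\{p,\ln(eM)\}}{M^{1/4}}.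 \end{aligned}$$ -/

import Mathlib

open MeasureTheory ProbabilityTheory

noncomputable section

namespace ClippedDNN

/-- The coordinate of `θ ∈ ℝ^D` with zero-based number `k` (only ever used for `k < D`). -/
def coord {D : ℕ} (θ : Fin D → ℝ) (k : ℕ) : ℝ :=
  if h : k < D then θ ⟨k, h⟩ else 0

/-- The affine function `ℝ^n → ℝ^m` whose weight matrix (row by row) and then whose bias vector
are read off from `θ`, after skipping the first `s` coordinates. -/
def affine {D : ℕ} (θ : Fin D → ℝ) (s m n : ℕ) (x : Fin n → ℝ) : Fin m → ℝ :=
  fun i => (∑ j : Fin n, coord θ (s + (i : ℕ) * n + (j : ℕ)) * x j)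
    + coord θ (s + m * n + (i : ℕ))

/-- `∑_{i=1}^k l_i (l_{i-1} + 1)`, the number of parameters of the first `k` layers. -/
def numParams (l : ℕ → ℕ) (k : ℕ) : ℕ :=
  ∑ i ∈ Finset.Icc 1 k, l i * (l (i - 1) + 1)

/-- The composition `act_k ∘ A_k ∘ ⋯ ∘ act_1 ∘ A_1` of the first `k` layers, where `A_i` is the
affine function `ℝ^{l_{i-1}} → ℝ^{l_i}` read off from `θ` after the parameters of the previous
layers. -/
def layers {D : ℕ} (θ : Fin D → ℝ) (l : ℕ → ℕ)
    (act : (k : ℕ) → (Fin (l k) → ℝ) → (Fin (l k) → ℝ)) :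
    (k : ℕ) → (Fin (l 0) → ℝ) → (Fin (l k) → ℝ)
  | 0, x => x
  | k + 1, x => act (k + 1) (affine θ (numParams l k) (l (k + 1)) (l k) (layers θ l act k x))

/-- The rectifier function. -/
def rect (x : ℝ) : ℝ := max x 0

/-- The clipping function with values in `[u, v]`. -/
def clip (u v x : ℝ) : ℝ := max (min x v) u

/-- The rectified clipped network with architecture `(l_0, …, l_depth)`: the rectifier acts
componentwise after the layers `1, …, depth - 1`, the clipping function after the last layer. -/
def clippedNet {D : ℕ} (θ : Fin D → ℝ) (l : ℕ → ℕ) (depth : ℕ) (u v : ℝ) :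
    (Fin (l 0) → ℝ) → (Fin (l depth) → ℝ) :=
  layers θ l (fun k y i => if k < depth then rect (y i) else clip u v (y i)) depth

/-- The same network for `l_0 = d` and `l_depth = 1`, as a function `ℝ^d → ℝ`. -/
def scalarNet {D d depth : ℕ} {l : ℕ → ℕ} (h0 : l 0 = d) (h1 : l depth = 1) (u v : ℝ)
    (θ : Fin D → ℝ) (x : Fin d → ℝ) : ℝ :=
  clippedNet θ l depth u v (fun i => x (i.cast h0)) ((0 : Fin 1).cast h1.symm)

/-- The cube `[a, b]^d`. -/
def cube (d : ℕ) (a b : ℝ) : Set (Fin d → ℝ) := Set.Icc (fun _ => a) (fun _ => b)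

/-- The maximum of `l_0, …, l_depth`. -/
def maxWidth (l : ℕ → ℕ) (depth : ℕ) : ℕ := (Finset.range (depth + 1)).sup l

/-- `min {2^(depth - 1), l_1, …, l_{depth - 1}}`. -/
def archMin (l : ℕ → ℕ) (depth : ℕ) : ℕ :=
  (insert (2 ^ (depth - 1)) ((Finset.Icc 1 (depth - 1)).image l)).min'
    (Finset.insert_nonempty _ _)

/-- The empirical risk of `F` on the sample `(x_1, y_1), …, (x_M, y_M)`. -/
def empiricalRisk {d : ℕ} (M : ℕ) (F : (Fin d → ℝ) → ℝ) (x : ℕ → Fin d → ℝ) (y : ℕ → ℝ) : ℝ :=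
  1 / (M : ℝ) * ∑ j ∈ Finset.Icc 1 M, |F (x j) - y j| ^ 2

/-- The set of minimizers of `f` over `S`. -/
def argMin {α : Type*} (S : Set α) (f : α → ℝ) : Set α :=
  {z | z ∈ S ∧ ∀ w ∈ S, f z ≤ f w}

end ClippedDNN

end

/-! The squared $L^2$-error splits into three parts. By the bias-variance decomposition, the squared
$L^2(\mathbb P_{X_1})$-distance of a network to $\mathcal E$ is its risk minus a constant
independent of the network. Compare the selected parameter with a fixed good approximant
$\vartheta$: replace risk by empirical risk twice, each time at the cost of the uniform deviation
$G$; use that the selected parameter is empirically at least as good as every initialization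
$\Theta_{k,0}$; and move from the initialization closest to $\vartheta$ to $\vartheta$ itself by
Lipschitz continuity in the parameters. Almost surely this gives error $\le\varepsilon^2+2G+\lambda
Z$, where $\varepsilon$ is the approximation error of $\vartheta$ and $Z$ the distance from
$\vartheta$ to the closest initialization. Since $G$ is uniform in $\theta$, it applies to the
data-dependent selected parameter. Minkowski's inequality in $L^s$, $s=\max\{p/2,1\}$, and a square
root then produce the three summands.

Approximation (`exists_scalarNet_approx`): on a grid of $m^d$ points $g_q$, the function
$\max_q(\mathcal E(g_q)-L\|x-g_q\|_1)$ lies below $\mathcal E$ by at most $2L$ times the distance to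
the nearest grid point. One hidden layer computes all $|x_i-g_j|$, a binary tree of pairwise maxima
does the rest, and all weights stay bounded by $c$.

Generalization (`exists_generalization_bound`): cover the parameter cube by finitely many centers,
apply Hoeffding's inequality at each center, and bound the $L^s$-norm of the maximum by choosing the
exponent as large as the logarithm of the number of centers (`lp_sup_le_of_tail`).

Optimization (`lp_inf_paramDist_le`): a uniform point lies within $t\le 2c$ of $\vartheta$, in the
$n$ coordinates that the network reads, with probability at least $(t/2c)^n$; the best of $K$
independent points is thus at distance of order $K^{-1/n}$, and $n\le\mathbf L W^2$. -/

noncomputable section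

namespace ClippedDNN

/-! ### Networks: size, Lipschitz continuity in the parameters, continuity -/

section

lemma abs_rect_sub_rect_le (x y : ℝ) : |rect x - rect y| ≤ |x - y| :=
  abs_max_sub_max_le_abs x y 0

lemma abs_rect_le (x : ℝ) : |rect x| ≤ |x| := by
  simpa [rect] using abs_rect_sub_rect_le x 0

lemma abs_clip_sub_clip_le (u v x y : ℝ) : |clip u v x - clip u v y| ≤ |x - y| :=
  (abs_max_sub_max_le_abs _ _ u).trans (abs_min_sub_min_le_max x v y v |>.trans (by simp))

lemma clip_mem {u v : ℝ} (huv : u ≤ v) (x : ℝ) : clip u v x ∈ Set.Icc u v :=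
  ⟨le_max_right _ _, max_le (min_le_right _ _) huv⟩

lemma clip_of_mem {u v x : ℝ} (hx : x ∈ Set.Icc u v) : clip u v x = x := by
  simp [clip, hx.1, hx.2]

/-- The activation functions of the rectified clipped networks. -/
def netAct (l : ℕ → ℕ) (depth : ℕ) (u v : ℝ) (k : ℕ) (y : Fin (l k) → ℝ) (i : Fin (l k)) : ℝ :=
  if k < depth then rect (y i) else clip u v (y i)

lemma numParams_succ (l : ℕ → ℕ) (k : ℕ) :
    numParams l (k + 1) = numParams l k + (l (k + 1) * l k + l (k + 1)) := by
  simp [numParams, Finset.sum_Icc_succ_top, mul_add]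

lemma numParams_mono (l : ℕ → ℕ) : Monotone (numParams l) :=
  monotone_nat_of_le_succ fun k => by rw [numParams_succ]; omega

lemma weight_index_lt {s m n : ℕ} (i : Fin m) (j : Fin n) :
    s + (i : ℕ) * n + (j : ℕ) < s + m * n := by
  have h : ((i : ℕ) + 1) * n ≤ m * n := Nat.mul_le_mul_right _ i.2
  have := j.2
  rw [add_mul] at h
  omega

lemma affine_congr {D : ℕ} {θ θ' : Fin D → ℝ} {s m n : ℕ}
    (h : ∀ q < s + (m * n + m), coord θ q = coord θ' q) (x : Fin n → ℝ) :
    affine θ s m n x = affine θ' s m n x := by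
  funext i
  have hi := i.2
  unfold affine
  rw [h (s + m * n + i) (by omega)]
  congr 1
  refine Finset.sum_congr rfl fun j _ => ?_
  rw [h _ (by have := weight_index_lt (s := s) i j; omega)]

/-- This locality lets parameter vectors be built one layer at a time: writing a later block does
not disturb the layers already constructed. -/
lemma layers_congr {D : ℕ} {θ θ' : Fin D → ℝ} {l : ℕ → ℕ}
    (act : (k : ℕ) → (Fin (l k) → ℝ) → (Fin (l k) → ℝ)) (k : ℕ)
    (h : ∀ q < numParams l k, coord θ q = coord θ' q) (x : Fin (l 0) → ℝ) :
    layers θ l act k x = layers θ' l act k x := by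
  induction k with
  | zero => rfl
  | succ k ih =>
    rw [numParams_succ] at h
    simp only [layers]
    rw [ih fun q hq => h q (by omega), affine_congr h]

lemma abs_affine_le {D : ℕ} {θ : Fin D → ℝ} {s m n : ℕ} {B Z : ℝ}
    (hθ : ∀ q < s + (m * n + m), |coord θ q| ≤ B) {x : Fin n → ℝ}
    (hx : ∀ j, |x j| ≤ Z) (hZ : 1 ≤ Z) (hB : 0 ≤ B) (i : Fin m) :
    |affine θ s m n x i| ≤ B * ((n : ℝ) + 1) * Z := by
  have hi := i.2
  unfold affine
  have h1 : |∑ j : Fin n, coord θ (s + (i : ℕ) * n + (j : ℕ)) * x j| ≤ ∑ _j : Fin n, B * Z := by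
    refine (Finset.abs_sum_le_sum_abs _ _).trans (Finset.sum_le_sum fun j _ => ?_)
    rw [abs_mul]
    exact mul_le_mul (hθ _ (by have := weight_index_lt (s := s) i j; omega)) (hx j)
      (abs_nonneg _) hB
  have h2 := hθ (s + m * n + i) (by omega)
  refine (abs_add_le _ _).trans ?_
  simp only [Finset.sum_const, Finset.card_univ, Fintype.card_fin, nsmul_eq_mul] at h1
  nlinarith

lemma abs_affine_sub_affine_le {D : ℕ} {θ θ' : Fin D → ℝ} {s m n : ℕ} {B Z δ ε : ℝ}
    (hθ : ∀ q < s + (m * n + m), |coord θ q| ≤ B)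
    (hδ : ∀ q < s + (m * n + m), |coord θ q - coord θ' q| ≤ δ) {x x' : Fin n → ℝ}
    (hx : ∀ j, |x' j| ≤ Z) (hZ : 1 ≤ Z) (hB : 0 ≤ B) (hδ0 : 0 ≤ δ)
    (hxx : ∀ j, |x j - x' j| ≤ ε) (i : Fin m) :
    |affine θ s m n x i - affine θ' s m n x' i| ≤ δ * ((n : ℝ) + 1) * Z + B * n * ε := by
  have hi := i.2
  have h2 := hδ (s + m * n + i) (by omega)
  have h1 : |∑ j : Fin n, (coord θ (s + (i : ℕ) * n + (j : ℕ)) * x j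
      - coord θ' (s + (i : ℕ) * n + (j : ℕ)) * x' j)| ≤ ∑ _j : Fin n, (δ * Z + B * ε) := by
    refine (Finset.abs_sum_le_sum_abs _ _).trans (Finset.sum_le_sum fun j _ => ?_)
    have hq : s + (i : ℕ) * n + (j : ℕ) < s + (m * n + m) := by
      have := weight_index_lt (s := s) i j; omega
    have e : coord θ (s + (i : ℕ) * n + (j : ℕ)) * x j
        - coord θ' (s + (i : ℕ) * n + (j : ℕ)) * x' j
        = (coord θ (s + (i : ℕ) * n + (j : ℕ)) - coord θ' (s + (i : ℕ) * n + (j : ℕ))) * x' j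
          + coord θ (s + (i : ℕ) * n + (j : ℕ)) * (x j - x' j) := by ring
    rw [e]
    refine (abs_add_le _ _).trans (add_le_add ?_ ?_) <;> rw [abs_mul]
    · exact mul_le_mul (hδ _ hq) (hx j) (abs_nonneg _) hδ0
    · exact mul_le_mul (hθ _ hq) (hxx j) (abs_nonneg _) hB
  rw [Finset.sum_sub_distrib] at h1
  simp only [Finset.sum_const, Finset.card_univ, Fintype.card_fin, nsmul_eq_mul] at h1
  unfold affine
  rw [add_sub_add_comm]
  refine (abs_add_le _ _).trans ?_
  nlinarith

lemma abs_netAct_sub_le (l : ℕ → ℕ) (depth : ℕ) (u v : ℝ) (k : ℕ) (y y' : Fin (l k) → ℝ)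
    (i : Fin (l k)) : |netAct l depth u v k y i - netAct l depth u v k y' i| ≤ |y i - y' i| := by
  unfold netAct
  split_ifs
  · exact abs_rect_sub_rect_le _ _
  · exact abs_clip_sub_clip_le _ _ _ _

/-- Each layer multiplies the bound by at most `B * w`; the bias is absorbed because the bound stays
at least `1`. Only hidden layers are covered, since clipping, unlike the rectifier, may increase
absolute values. -/
lemma abs_layers_le {D depth : ℕ} {θ : Fin D → ℝ} {l : ℕ → ℕ} {u v B w c : ℝ}
    (hB : 1 ≤ B) (hc : 1 ≤ c) (hw : 1 ≤ w) (hlw : ∀ k ≤ depth, (l k : ℝ) + 1 ≤ w)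
    (hθ : ∀ q < numParams l depth, |coord θ q| ≤ B)
    {x : Fin (l 0) → ℝ} (hx : ∀ i, |x i| ≤ c) (k : ℕ) (hk : k < depth) (i : Fin (l k)) :
    |layers θ l (netAct l depth u v) k x i| ≤ (B * w) ^ k * c := by
  induction k with
  | zero => simpa [layers] using hx i
  | succ k ih =>
    have h1 : 1 ≤ B * w := one_le_mul_of_one_le_of_one_le hB hw
    have h2 : 1 ≤ (B * w) ^ k * c := one_le_mul_of_one_le_of_one_le (one_le_pow₀ h1) hc
    have hn : numParams l k + (l (k + 1) * l k + l (k + 1)) ≤ numParams l depth := by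
      rw [← numParams_succ]; exact numParams_mono l hk.le
    simp only [layers, netAct, if_pos hk]
    refine (abs_rect_le _).trans ((abs_affine_le (fun q hq => hθ q (hq.trans_le hn))
      (ih (by omega)) h2 (by linarith) i).trans ?_)
    have h3 := hlw k (by omega)
    calc B * ((l k : ℝ) + 1) * ((B * w) ^ k * c) ≤ B * w * ((B * w) ^ k * c) := by gcongr
      _ = (B * w) ^ (k + 1) * c := by ring

/-- A new layer amplifies the previous difference by at most `B * w` and adds `δ * w` times the size
`(B * w) ^ k * c` of its input. All contributions have the same order, hence the factor `k`. -/
lemma abs_layers_sub_layers_le {D depth : ℕ} {θ θ' : Fin D → ℝ} {l : ℕ → ℕ} {u v B w c δ : ℝ}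
    (hB : 1 ≤ B) (hc : 1 ≤ c) (hw : 1 ≤ w) (hlw : ∀ k ≤ depth, (l k : ℝ) + 1 ≤ w)
    (hθ : ∀ q < numParams l depth, |coord θ q| ≤ B)
    (hθ' : ∀ q < numParams l depth, |coord θ' q| ≤ B)
    (hδ0 : 0 ≤ δ) (hδ : ∀ q < numParams l depth, |coord θ q - coord θ' q| ≤ δ)
    {x : Fin (l 0) → ℝ} (hx : ∀ i, |x i| ≤ c) (k : ℕ) (hk : k ≤ depth) (i : Fin (l k)) :
    |layers θ l (netAct l depth u v) k x i - layers θ' l (netAct l depth u v) k x i|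
      ≤ k * w ^ k * B ^ (k - 1) * c * δ := by
  induction k with
  | zero => simp [layers]
  | succ k ih =>
    have h1 : 1 ≤ B * w := one_le_mul_of_one_le_of_one_le hB hw
    have h2 : 1 ≤ (B * w) ^ k * c := one_le_mul_of_one_le_of_one_le (one_le_pow₀ h1) hc
    have hn : numParams l k + (l (k + 1) * l k + l (k + 1)) ≤ numParams l depth := by
      rw [← numParams_succ]; exact numParams_mono l hk
    simp only [layers]
    refine (abs_netAct_sub_le _ _ _ _ _ _ _ _).trans ((abs_affine_sub_affine_le
      (fun q hq => hθ q (hq.trans_le hn)) (fun q hq => hδ q (hq.trans_le hn))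
      (abs_layers_le (u := u) (v := v) hB hc hw hlw hθ' hx k (by omega)) h2 (by linarith) hδ0
      (ih (by omega)) i).trans ?_)
    have h3 := hlw k (by omega)
    have h4 : (l k : ℝ) ≤ w := by linarith
    -- For `k = 0` the truncated exponent `k - 1` is wrong by one, but the factor `k` vanishes.
    have h5 : B * (k * w ^ k * B ^ (k - 1) * c * δ) = k * w ^ k * B ^ k * c * δ := by
      rcases k with _ | k
      · simp
      · simp only [Nat.add_sub_cancel]; ring
    calc δ * ((l k : ℝ) + 1) * ((B * w) ^ k * c) + B * l k * (k * w ^ k * B ^ (k - 1) * c * δ)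
        ≤ δ * w * ((B * w) ^ k * c) + w * (B * (k * w ^ k * B ^ (k - 1) * c * δ)) := by
          rw [mul_comm B (l k : ℝ), mul_assoc (l k : ℝ)]
          gcongr
      _ = _ := by rw [h5, Nat.add_sub_cancel]; push_cast; ring

lemma abs_coord_le_norm {D : ℕ} (θ : Fin D → ℝ) (q : ℕ) : |coord θ q| ≤ ‖θ‖ := by
  unfold coord
  split_ifs with h
  · exact norm_le_pi_norm θ ⟨q, h⟩
  · simp

lemma abs_le_of_mem_cube {d : ℕ} {a b c : ℝ} (hca : |a| ≤ c) (hcb : |b| ≤ c) {x : Fin d → ℝ}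
    (hx : x ∈ cube d a b) (i : Fin d) : |x i| ≤ c :=
  abs_le.2 ⟨(abs_le.1 hca).1.trans (hx.1 i), (hx.2 i).trans (abs_le.1 hcb).2⟩

lemma le_maxWidth (l : ℕ → ℕ) {depth k : ℕ} (hk : k ≤ depth) : l k ≤ maxWidth l depth :=
  Finset.le_sup (f := l) (Finset.mem_range.2 (by omega))

/-- Rectified clipped networks are Lipschitz continuous in the parameters that they use. -/
lemma abs_scalarNet_sub_scalarNet_le {D d depth : ℕ} {l : ℕ → ℕ} (h0 : l 0 = d)
    (h1 : l depth = 1) {u v B c δ : ℝ} (hB : 1 ≤ B) (hc : 1 ≤ c) {θ θ' : Fin D → ℝ}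
    (hθ : ‖θ‖ ≤ B) (hθ' : ‖θ'‖ ≤ B) (hδ0 : 0 ≤ δ)
    (hδ : ∀ q < numParams l depth, |coord θ q - coord θ' q| ≤ δ)
    {x : Fin d → ℝ} (hx : ∀ i, |x i| ≤ c) :
    |scalarNet h0 h1 u v θ x - scalarNet h0 h1 u v θ' x|
      ≤ depth * ((maxWidth l depth : ℝ) + 1) ^ depth * B ^ (depth - 1) * c * δ :=
  abs_layers_sub_layers_le hB hc (by linarith [Nat.cast_nonneg (α := ℝ) (maxWidth l depth)])
    (fun k hk => by have := le_maxWidth l hk; gcongr)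
    (fun q _ => (abs_coord_le_norm θ q).trans hθ) (fun q _ => (abs_coord_le_norm θ' q).trans hθ')
    hδ0 hδ (fun i => hx _) depth le_rfl _

lemma scalarNet_mem {D d depth : ℕ} {l : ℕ → ℕ} (h0 : l 0 = d) (h1 : l depth = 1)
    (hdepth : 1 ≤ depth) {u v : ℝ} (huv : u ≤ v) (θ : Fin D → ℝ) (x : Fin d → ℝ) :
    scalarNet h0 h1 u v θ x ∈ Set.Icc u v := by
  obtain ⟨k, rfl⟩ : ∃ k, depth = k + 1 := ⟨depth - 1, by omega⟩
  simp only [scalarNet, clippedNet, layers, lt_irrefl, if_false]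
  exact clip_mem huv _

lemma continuous_coord {D : ℕ} (q : ℕ) : Continuous fun θ : Fin D → ℝ => coord θ q := by
  unfold coord
  split_ifs
  · fun_prop
  · fun_prop

lemma continuous_layers {D : ℕ} (l : ℕ → ℕ) (depth : ℕ) (u v : ℝ) (k : ℕ) :
    Continuous fun z : (Fin D → ℝ) × (Fin (l 0) → ℝ) =>
      layers z.1 l (netAct l depth u v) k z.2 := by
  induction k with
  | zero => exact continuous_snd
  | succ k ih =>
    have hc (q : ℕ) : Continuous fun z : (Fin D → ℝ) × (Fin (l 0) → ℝ) => coord z.1 q :=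
      (continuous_coord q).comp continuous_fst
    simp only [layers]
    refine continuous_pi fun i => ?_
    have ha : Continuous fun z : (Fin D → ℝ) × (Fin (l 0) → ℝ) =>
        affine z.1 (numParams l k) (l (k + 1)) (l k) (layers z.1 l (netAct l depth u v) k z.2) i :=
      (continuous_finsetSum _ fun j _ => (hc _).mul ((continuous_apply j).comp ih)).add (hc _)
    unfold netAct
    split_ifs
    · exact ha.max continuous_const
    · exact (ha.min continuous_const).max continuous_const

lemma continuous_scalarNet {D d depth : ℕ} {l : ℕ → ℕ} (h0 : l 0 = d) (h1 : l depth = 1)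
    (u v : ℝ) :
    Continuous fun z : (Fin D → ℝ) × (Fin d → ℝ) => scalarNet h0 h1 u v z.1 z.2 :=
  (continuous_apply _).comp ((continuous_layers l depth u v depth).comp
    (continuous_fst.prodMk (continuous_pi fun i => (continuous_apply (i.cast h0)).comp
      continuous_snd)))

lemma numParams_le (l : ℕ → ℕ) (depth : ℕ) :
    numParams l depth ≤ depth * (maxWidth l depth + 1) ^ 2 := by
  unfold numParams
  refine (Finset.sum_le_card_nsmul _ _ ((maxWidth l depth + 1) ^ 2) fun i hi => ?_).trans
    (by simp)
  rw [Finset.mem_Icc] at hi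
  have h1 := le_maxWidth l hi.2
  have h2 := le_maxWidth l (depth := depth) (k := i - 1) (by omega)
  rw [sq]
  exact Nat.mul_le_mul (by omega) (by omega)

lemma numParams_pos {l : ℕ → ℕ} {depth : ℕ} (hdepth : 1 ≤ depth) (hl : 1 ≤ l 1) :
    0 < numParams l depth := by
  have h := numParams_mono l hdepth
  rw [numParams_succ l 0, zero_add] at h
  omega

end

/-! ### Approximation of Lipschitz functions by networks -/

section

/-- Weights and biases are written into the block starting at `s`; quotient and remainder modulo `n`
recover row and column from the position. -/
lemma exists_affine_eq {D s m n : ℕ} {c : ℝ} (hc : 0 ≤ c) (hD : s + (m * n + m) ≤ D)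
    {θ : Fin D → ℝ} (hθ : ‖θ‖ ≤ c) {w : Fin m → Fin n → ℝ} {β : Fin m → ℝ}
    (hw : ∀ i j, |w i j| ≤ c) (hβ : ∀ i, |β i| ≤ c) :
    ∃ θ' : Fin D → ℝ, ‖θ'‖ ≤ c ∧ (∀ q < s, coord θ' q = coord θ q) ∧
      ∀ x i, affine θ' s m n x i = ∑ j, w i j * x j + β i := by
  let w' (i j : ℕ) : ℝ := if h : i < m ∧ j < n then w ⟨i, h.1⟩ ⟨j, h.2⟩ else 0
  let β' (i : ℕ) : ℝ := if h : i < m then β ⟨i, h⟩ else 0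
  let g (q : ℕ) : ℝ := if q < s then coord θ q else
    if q - s < m * n then w' ((q - s) / n) ((q - s) % n) else β' (q - s - m * n)
  have hg (q : ℕ) : |g q| ≤ c := by
    simp only [g, w', β']
    split_ifs
    · exact (abs_coord_le_norm θ q).trans hθ
    · exact hw _ _
    · simpa using hc
    · exact hβ _
    · simpa using hc
  have hco (q : ℕ) (hq : q < D) : coord (fun i : Fin D => g i) q = g q := by simp [coord, hq]
  refine ⟨fun i => g i, (pi_norm_le_iff_of_nonneg hc).2 fun i => hg i, fun q hq => ?_,
    fun x i => ?_⟩
  · rw [hco q (by omega)]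
    simp [g, hq]
  · have hi := i.2
    unfold affine
    congr 1
    · refine Finset.sum_congr rfl fun j _ => ?_
      have hij := weight_index_lt (s := s) i j
      have hj := j.2
      rw [hco _ (by omega)]
      have h1 : ¬ s + (i : ℕ) * n + j < s := by omega
      have h2 : s + (i : ℕ) * n + j - s = j + n * i := by rw [mul_comm n]; omega
      have h3 : j + n * (i : ℕ) < m * n := by rw [mul_comm n]; omega
      have h4 : (j + n * (i : ℕ)) / n = i := by
        rw [Nat.add_mul_div_left _ _ (by omega), Nat.div_eq_of_lt hj, zero_add]
      have h5 : (j + n * (i : ℕ)) % n = j := by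
        rw [Nat.add_mul_mod_self_left, Nat.mod_eq_of_lt hj]
      simp [g, h1, h2, h3, h4, h5, w']
    · rw [hco _ (by omega)]
      have h1 : ¬ s + m * n + (i : ℕ) < s := by omega
      have h2 : ¬ s + m * n + (i : ℕ) - s < m * n := by omega
      have h3 : s + m * n + (i : ℕ) - s - m * n = i := by omega
      simp [g, h1, h2, h3, β']

lemma sum_extend_mul {κ ι : Type*} [Fintype κ] [Fintype ι] (e : κ ↪ ι) (f : κ → ℝ) (y : ι → ℝ) :
    ∑ i, Function.extend e f 0 i * y i = ∑ z, f z * y (e z) :=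
  (Fintype.sum_of_injective e e.injective _ _
    (fun i hi => by rw [Function.extend_apply' _ _ _ (by simpa using hi)]; simp)
    (fun z => by rw [e.injective.extend_apply])).symm

lemma abs_extend_le {κ ι : Type*} (e : κ ↪ ι) {f : κ → ℝ} {c : ℝ} (hc : 0 ≤ c)
    (hf : ∀ z, |f z| ≤ c) (i : ι) : |Function.extend e f 0 i| ≤ c := by
  by_cases h : ∃ z, e z = i
  · obtain ⟨z, rfl⟩ := h
    rw [e.injective.extend_apply]
    exact hf z
  · rw [Function.extend_apply' _ _ _ h]
    simpa using hc

/-- One more hidden layer, some of whose neurons are prescribed. -/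
lemma exists_hidden_layer {D depth k : ℕ} {l : ℕ → ℕ} {u v c : ℝ} (hc : 0 ≤ c)
    (hD : numParams l (k + 1) ≤ D) (hk : k + 1 < depth) {θ : Fin D → ℝ} (hθ : ‖θ‖ ≤ c)
    {κ : Type*} (e : κ ↪ Fin (l (k + 1))) {w : κ → Fin (l k) → ℝ} {β : κ → ℝ}
    (hw : ∀ z j, |w z j| ≤ c) (hβ : ∀ z, |β z| ≤ c) :
    ∃ θ' : Fin D → ℝ, ‖θ'‖ ≤ c ∧ ∀ x z, layers θ' l (netAct l depth u v) (k + 1) x (e z)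
      = rect (∑ j, w z j * layers θ l (netAct l depth u v) k x j + β z) := by
  rw [numParams_succ] at hD
  obtain ⟨θ', h1, h2, h3⟩ := exists_affine_eq hc hD hθ
    (w := fun i j => Function.extend e (fun z => w z j) 0 i) (β := Function.extend e β 0)
    (fun i j => abs_extend_le e hc (fun z => hw z j) i) (abs_extend_le e hc hβ)
  refine ⟨θ', h1, fun x z => ?_⟩
  simp only [layers, netAct, if_pos hk, h3, e.injective.extend_apply]
  rw [layers_congr _ k h2]

/-- The functions `V p` are affine functions of the `k`-th layer of a network whose parameters are
bounded by `c`, with coefficients that are bounded by `c` and mutually differ by at most `c`. -/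
def Representable (D : ℕ) (l : ℕ → ℕ) (depth : ℕ) (u v c : ℝ) (k : ℕ) {ι : Type*}
    (V : ι → (Fin (l 0) → ℝ) → ℝ) : Prop :=
  ∃ θ : Fin D → ℝ, ‖θ‖ ≤ c ∧ ∃ (dec : ι → Fin (l k) → ℝ) (cst : ι → ℝ),
    (∀ p j, |dec p j| ≤ c) ∧ (∀ p, |cst p| ≤ c) ∧ (∀ p p' j, |dec p j - dec p' j| ≤ c) ∧
    (∀ p p', |cst p - cst p'| ≤ c) ∧
    ∀ x p, ∑ j, dec p j * layers θ l (netAct l depth u v) k x j + cst p = V p x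

lemma Representable.comp {D depth k : ℕ} {l : ℕ → ℕ} {u v c : ℝ} {ι ι' : Type*}
    {V : ι → (Fin (l 0) → ℝ) → ℝ} (h : Representable D l depth u v c k V) (f : ι' → ι) :
    Representable D l depth u v c k fun p => V (f p) := by
  obtain ⟨θ, hθ, dec, cst, h1, h2, h3, h4, h5⟩ := h
  exact ⟨θ, hθ, dec ∘ f, cst ∘ f, fun _ => h1 _, fun _ => h2 _, fun _ _ => h3 _ _,
    fun _ _ => h4 _ _, fun x _ => h5 x _⟩

lemma rect_sub_rect_neg (x : ℝ) : rect x - rect (-x) = x := by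
  unfold rect
  rcases le_total x 0 with h | h
  · rw [max_eq_right h, max_eq_left (by linarith)]; ring
  · rw [max_eq_left h, max_eq_right (by linarith)]; ring

lemma rect_add_rect_neg (x : ℝ) : rect x + rect (-x) = |x| := by
  unfold rect
  rcases le_total x 0 with h | h
  · rw [max_eq_right h, max_eq_left (by linarith), abs_of_nonpos h]; ring
  · rw [max_eq_left h, max_eq_right (by linarith), abs_of_nonneg h]; ring

lemma rect_sub_add (x y : ℝ) : rect (x - y) + y = max x y := by
  unfold rect
  rw [← max_add_add_right]
  simp

/-- With $r$ the rectifier, $\max(x,y)=r(x-y)+r(y)-r(-y)$ costs three neurons. The first has the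
difference of two coefficient vectors as its weights, which is why `Representable` also bounds
mutual differences by `c`. -/
lemma Representable.max {D depth k : ℕ} {l : ℕ → ℕ} {u v c : ℝ} (hc : 1 ≤ c)
    (hD : numParams l (k + 1) ≤ D) (hk : k + 1 < depth) {ι ι' : Type*} [Fintype ι']
    {V : ι → (Fin (l 0) → ℝ) → ℝ} (h : Representable D l depth u v c k V) (f g : ι' → ι)
    (hι : 3 * Fintype.card ι' ≤ l (k + 1)) :
    Representable D l depth u v c (k + 1) fun p x => max (V (f p) x) (V (g p) x) := by
  classical
  obtain ⟨θ, hθ, dec, cst, h1, h2, h3, h4, h5⟩ := h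
  obtain ⟨e⟩ : Nonempty (ι' × Fin 3 ↪ Fin (l (k + 1))) :=
    Function.Embedding.nonempty_of_card_le (by simpa [mul_comm] using hι)
  obtain ⟨θ', hθ', hl⟩ := exists_hidden_layer (u := u) (v := v) (by linarith) hD hk hθ e
    (w := fun z j => ![dec (f z.1) j - dec (g z.1) j, dec (g z.1) j, -dec (g z.1) j] z.2)
    (β := fun z => ![cst (f z.1) - cst (g z.1), cst (g z.1), -cst (g z.1)] z.2) (c := c)
    (by rintro ⟨p, r⟩ j; fin_cases r <;> simp [h1, h3])
    (by rintro ⟨p, r⟩; fin_cases r <;> simp [h2, h4])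
  have hone (r : Fin 3) : |(![1, 1, -1] r : ℝ)| ≤ 1 := by fin_cases r <;> simp
  refine ⟨θ', hθ', fun p => Function.extend e (fun z => if z.1 = p then ![1, 1, -1] z.2 else 0) 0,
    0, fun p => abs_extend_le e (by linarith) fun z => ?_, fun p => ?_, fun p p' j => ?_,
    fun p p' => ?_, fun x p => ?_⟩
  · split_ifs
    · exact (hone _).trans hc
    · simp; linarith
  · simp; linarith
  -- Different outputs read disjoint triples of neurons, so coefficients with values `±1` differ by
  -- at most `1`, not `2`.
  · dsimp only
    refine le_trans ?_ hc
    by_cases h : ∃ z, e z = j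
    · obtain ⟨z, rfl⟩ := h
      rw [e.injective.extend_apply, e.injective.extend_apply]
      split_ifs with h h'
      · simp
      · simpa using hone _
      · simpa using hone _
      · simp
    · rw [Function.extend_apply' _ _ _ h, Function.extend_apply' _ _ _ h]
      simp
  · simp; linarith
  · rw [sum_extend_mul, Fintype.sum_prod_type, Finset.sum_eq_single p (by
      intro q _ hq; simp [hq]) (by simp)]
    simp only [if_true, hl, Fin.sum_univ_three, Pi.zero_apply, add_zero]
    have hf := h5 x (f p)
    have hg := h5 x (g p)
    simp only [Matrix.cons_val, sub_mul, neg_mul, Finset.sum_sub_distrib, Finset.sum_neg_distrib]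
    set y := layers θ l (netAct l depth u v) k x
    have e1 : ∑ j, dec (f p) j * y j - ∑ j, dec (g p) j * y j + (cst (f p) - cst (g p))
        = V (f p) x - V (g p) x := by rw [← hf, ← hg]; ring
    have e2 : -∑ j, dec (g p) j * y j + -cst (g p) = -V (g p) x := by rw [← hg]; ring
    rw [e1, hg, e2, ← rect_sub_add]
    linarith [rect_sub_rect_neg (V (g p) x)]

/-- The two neurons for $|t|=r(t)+r(-t)$, with $r$ the rectifier and $t=x_i-g_j$, are shared by all
grid points, so the width is `2 * (l 0 * m)` and not of order `m ^ l 0`. The values `φ q` are at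
most `c / 2` in absolute value, so their differences are at most `c`; this is the role of the factor
`2` in `hcu` and `hcv`. -/
lemma representable_distances {D depth m : ℕ} {l : ℕ → ℕ} {u v c Lip : ℝ} (hc : 1 ≤ c)
    (hD : numParams l 1 ≤ D) (hdepth : 1 < depth) (hm : 2 * (l 0 * m) ≤ l 1)
    (hLip : 0 ≤ Lip) (hLc : Lip ≤ c) (hcu : 2 * |u| ≤ c) (hcv : 2 * |v| ≤ c)
    {g : Fin m → ℝ} (hg : ∀ j, |g j| ≤ c) {φ : (Fin (l 0) → Fin m) → ℝ}
    (hφ : ∀ q, φ q ∈ Set.Icc u v) :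
    Representable D l depth u v c 1 fun (q : Fin (l 0) → Fin m) x =>
      φ q - Lip * ∑ i, |x i - g (q i)| := by
  classical
  have hφ' (q) : |φ q| ≤ c / 2 := by
    refine (abs_le_max_abs_abs (hφ q).1 (hφ q).2).trans (max_le ?_ ?_) <;> linarith
  obtain ⟨e⟩ : Nonempty (Bool × Fin (l 0) × Fin m ↪ Fin (l 1)) :=
    Function.Embedding.nonempty_of_card_le (by simpa using hm)
  obtain ⟨θ, hθ, hl⟩ := exists_hidden_layer (D := D) (θ := 0) (u := u) (v := v) (by linarith) hD
    hdepth (by simp; linarith) e (c := c)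
    (w := fun z j => if j = z.2.1 then (if z.1 then 1 else -1) else 0)
    (β := fun z => if z.1 then -g z.2.2 else g z.2.2)
    (by rintro ⟨r, i, q⟩ j; cases r <;> simp <;> split_ifs <;> simp <;> linarith)
    (by rintro ⟨r, i, q⟩; cases r <;> simp [hg])
  refine ⟨θ, hθ, fun q => Function.extend e (fun z => if z.2.2 = q z.2.1 then -Lip else 0) 0,
    φ, fun p => abs_extend_le e (by linarith) fun z => ?_, fun p => ?_, fun p p' j => ?_,
    fun p p' => ?_, fun x p => ?_⟩
  · split_ifs
    · simpa [abs_of_nonneg hLip]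
    · simp; linarith
  · linarith [hφ' p]
  · dsimp only
    by_cases h : ∃ z, e z = j
    · obtain ⟨z, rfl⟩ := h
      rw [e.injective.extend_apply, e.injective.extend_apply]
      split_ifs <;> simp [abs_of_nonneg hLip] <;> linarith
    · rw [Function.extend_apply' _ _ _ h, Function.extend_apply' _ _ _ h]
      simp; linarith
  · exact (abs_sub _ _).trans (by linarith [hφ' p, hφ' p'])
  · rw [sum_extend_mul, Fintype.sum_prod_type]
    have hl' (r : Bool) (i : Fin (l 0)) (q : Fin m) :
        layers θ l (netAct l depth u v) 1 x (e (r, i, q))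
          = rect ((if r then 1 else -1) * (x i - g q)) := by
      refine (hl x (r, i, q)).trans (congrArg rect ?_)
      cases r <;> simp [layers] <;> ring
    simp only [Fintype.sum_prod_type, hl', Fintype.sum_bool, ite_mul, zero_mul, Finset.sum_ite_eq',
      Finset.mem_univ, if_true, Bool.false_eq_true, if_false, one_mul, neg_one_mul]
    rw [← Finset.sum_add_distrib]
    simp only [← mul_add, rect_add_rect_neg, ← Finset.mul_sum]
    ring

/-- The tree of pairwise maxima. -/
lemma exists_representable_of_max {D depth A n : ℕ} {l : ℕ → ℕ} {u v c : ℝ} (hc : 1 ≤ c)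
    (hD : numParams l depth ≤ D) (hl : ∀ i, 1 ≤ i → i < depth → A ≤ l i) (hA : 6 ≤ A)
    (hn : 1 ≤ n) (hnA : 2 * n ≤ A) {V : Fin n → (Fin (l 0) → ℝ) → ℝ}
    {F : (Fin (l 0) → ℝ) → ℝ} (hle : ∀ x q, V q x ≤ F x) (hex : ∀ x, ∃ q, V q x = F x)
    {k j : ℕ} (hnj : n ≤ 2 ^ j) (hkj : k + j < depth)
    (h : Representable D l depth u v c k V) :
    Representable D l depth u v c (k + j) fun (_ : Unit) => F := by
  induction j generalizing k n with
  | zero =>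
    obtain rfl : n = 1 := by simp at hnj; omega
    have hF : (fun _ : Unit => F) = fun _ => V 0 := by
      funext _ x
      obtain ⟨q, hq⟩ := hex x
      rw [← hq, Subsingleton.elim q 0]
    rw [hF]
    exact h.comp _
  | succ j ih =>
    have hA' := hl (k + 1) (by omega) (by omega)
    -- Neighbours are paired; for odd `n` the `min` pairs the last function with itself, so that for
    -- `n = 1` the layer just copies. The width `3 * ((n + 1) / 2)` fits since `2 * n ≤ A` and `6 ≤
    -- A`.
    have hmax := h.max hc ((numParams_mono l (by omega)).trans hD) (by omega : k + 1 < depth)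
      (fun q : Fin ((n + 1) / 2) => ⟨2 * q, by omega⟩)
      (fun q : Fin ((n + 1) / 2) => ⟨min (2 * q + 1) (n - 1), by omega⟩)
      (by simp; omega)
    rw [show k + (j + 1) = k + 1 + j by ring]
    refine ih (by omega) (by omega) (fun x q => ?_) (fun x => ?_) (by rw [pow_succ] at hnj; omega)
      (by omega) hmax
    · exact max_le (hle x _) (hle x _)
    · obtain ⟨q, hq⟩ := hex x
      refine ⟨⟨q / 2, by omega⟩, le_antisymm (max_le (hle x _) (hle x _)) ?_⟩
      have hq2 := q.2
      rcases Nat.even_or_odd' (q : ℕ) with ⟨r, hr | hr⟩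
      · refine hq.symm.le.trans (le_max_of_le_left (le_of_eq ?_))
        congr 1
        ext
        simp; omega
      · refine hq.symm.le.trans (le_max_of_le_right (le_of_eq ?_))
        congr 1
        ext
        simp; omega

lemma exists_scalarNet_eq_clip {D d k : ℕ} {l : ℕ → ℕ} (h0 : l 0 = d) (h1 : l (k + 1) = 1)
    {u v c : ℝ} (hc : 0 ≤ c) (hD : numParams l (k + 1) ≤ D) {F : (Fin (l 0) → ℝ) → ℝ}
    (h : Representable D l (k + 1) u v c k fun (_ : Unit) => F) :
    ∃ θ : Fin D → ℝ, ‖θ‖ ≤ c ∧ ∀ x : Fin d → ℝ,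
      scalarNet h0 h1 u v θ x = clip u v (F fun i => x (i.cast h0)) := by
  obtain ⟨θ, hθ, dec, cst, g1, g2, -, -, g5⟩ := h
  rw [numParams_succ] at hD
  obtain ⟨θ', f1, f2, f3⟩ := exists_affine_eq hc hD hθ (w := fun _ => dec ())
    (β := fun _ => cst ()) (fun _ => g1 _) (fun _ => g2 _)
  refine ⟨θ', f1, fun x => ?_⟩
  simp only [scalarNet, clippedNet, layers, lt_irrefl, if_false, f3]
  rw [layers_congr _ k f2]
  exact congrArg (clip u v) (g5 _ ())

lemma archMin_le_pow (l : ℕ → ℕ) (depth : ℕ) : archMin l depth ≤ 2 ^ (depth - 1) :=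
  Finset.min'_le _ _ (Finset.mem_insert_self _ _)

lemma archMin_le (l : ℕ → ℕ) {depth i : ℕ} (h1 : 1 ≤ i) (h2 : i < depth) :
    archMin l depth ≤ l i :=
  Finset.min'_le _ _ (Finset.mem_insert_of_mem (Finset.mem_image_of_mem l
    (Finset.mem_Icc.2 ⟨h1, by omega⟩)))

lemma one_le_archMin {l : ℕ → ℕ} {depth : ℕ} (hl : ∀ i ≤ depth, 1 ≤ l i) :
    1 ≤ archMin l depth := by
  refine Finset.le_min' _ _ _ fun y hy => ?_
  simp only [Finset.mem_insert, Finset.mem_image, Finset.mem_Icc] at hy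
  rcases hy with rfl | ⟨i, hi, rfl⟩
  · exact Nat.one_le_two_pow
  · exact hl i (by omega)

lemma abs_clip_sub_le {u v y z ε : ℝ} (hy : y ∈ Set.Icc u v) (h : |z - y| ≤ ε) :
    |clip u v z - y| ≤ ε := by
  have h1 := abs_clip_sub_clip_le u v z y
  rw [clip_of_mem hy] at h1
  exact h1.trans h

lemma exists_scalarNet_const {D d depth : ℕ} {l : ℕ → ℕ} (h0 : l 0 = d) (h1 : l depth = 1)
    (hdepth : 1 ≤ depth) {u v c : ℝ} (hc : 0 ≤ c) (hD : numParams l depth ≤ D) {y : ℝ}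
    (hy : y ∈ Set.Icc u v) (hyc : |y| ≤ c) :
    ∃ θ : Fin D → ℝ, ‖θ‖ ≤ c ∧ ∀ x : Fin d → ℝ, scalarNet h0 h1 u v θ x = y := by
  obtain ⟨k, rfl⟩ : ∃ k, depth = k + 1 := ⟨depth - 1, by omega⟩
  obtain ⟨θ, hθ, h⟩ := exists_scalarNet_eq_clip (u := u) (v := v) (F := fun _ => y) h0 h1 hc hD
    ⟨0, by simpa, 0, fun _ => y, by simp [hc], by simp [hyc], by simp [hc], by simp [hc], by simp⟩
  exact ⟨θ, hθ, fun x => by rw [h, clip_of_mem hy]⟩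

lemma exists_grid_point {a b : ℝ} (hab : a < b) {m : ℕ} (hm : 1 ≤ m) {t : ℝ}
    (ht : t ∈ Set.Icc a b) :
    ∃ j : Fin m, |t - (a + (b - a) * (2 * (j : ℕ) + 1) / (2 * m))| ≤ (b - a) / (2 * m) := by
  have hba : 0 < b - a := by linarith
  have hm' : (0 : ℝ) < m := by exact_mod_cast hm
  set s : ℝ := (t - a) * m / (b - a) with hs
  have hs0 : 0 ≤ s := div_nonneg (mul_nonneg (by linarith [ht.1]) hm'.le) hba.le
  have hsm : s ≤ m := by
    rw [hs, div_le_iff₀ hba, mul_comm]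
    exact mul_le_mul_of_nonneg_left (by linarith [ht.2]) hm'.le
  have hts : t = a + (b - a) * (2 * s) / (2 * m) := by rw [hs]; field_simp; ring
  -- At the right endpoint `t = b` the floor would be `m`, which is out of range; the last
  -- subinterval is used.
  have key : ∃ j : Fin m, (j : ℕ) ≤ s ∧ s ≤ (j : ℕ) + 1 := by
    rcases hsm.lt_or_eq with h | h
    · exact ⟨⟨⌊s⌋₊, (Nat.floor_lt hs0).2 h⟩, Nat.floor_le hs0, (Nat.lt_floor_add_one s).le⟩
    · refine ⟨⟨m - 1, by omega⟩, ?_, ?_⟩ <;> simp [Nat.cast_sub hm, h]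
  obtain ⟨j, h1, h2⟩ := key
  refine ⟨j, ?_⟩
  have e : t - (a + (b - a) * (2 * (j : ℕ) + 1) / (2 * m))
      = (b - a) / (2 * m) * (2 * (s - (j : ℕ)) - 1) := by
    rw [hts]; ring
  rw [e, abs_mul, abs_of_nonneg (by positivity)]
  refine mul_le_of_le_one_right (by positivity) (abs_le.2 ⟨by linarith, by linarith⟩)

lemma grid_mem {a b : ℝ} (hab : a < b) {m : ℕ} (j : Fin m) :
    a + (b - a) * (2 * (j : ℕ) + 1) / (2 * m) ∈ Set.Icc a b := by
  have hba : 0 < b - a := by linarith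
  have hj : ((j : ℕ) : ℝ) + 1 ≤ m := by exact_mod_cast j.2
  have hm' : (0 : ℝ) < m := by linarith [Nat.cast_nonneg (α := ℝ) (j : ℕ)]
  have h : (b - a) * (2 * (j : ℕ) + 1) / (2 * m) ≤ b - a := by
    rw [div_le_iff₀ (by positivity)]
    exact mul_le_mul_of_nonneg_left (by linarith) hba.le
  refine ⟨le_add_of_nonneg_right (by positivity), by linarith⟩

/-- Approximation of Lipschitz functions by rectified clipped networks. -/
theorem exists_scalarNet_approx {D d depth : ℕ} {l : ℕ → ℕ} (hd : 1 ≤ d) (h0 : l 0 = d)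
    (h1 : l depth = 1) (hdepth : 1 ≤ depth) (hl : ∀ i ≤ depth, 1 ≤ l i)
    {Lip a b u v c : ℝ} (hLip : 0 ≤ Lip) (hab : a < b) (hc : 1 ≤ c) (hcu : 2 * |u| ≤ c)
    (hcv : 2 * |v| ≤ c) (hca : |a| ≤ c) (hcb : |b| ≤ c) (hLc : Lip ≤ c)
    (hD : numParams l depth ≤ D) {E : (Fin d → ℝ) → ℝ} (hE : ∀ x ∈ cube d a b, E x ∈ Set.Icc u v)
    (hEL : ∀ x ∈ cube d a b, ∀ y ∈ cube d a b, |E x - E y| ≤ Lip * ∑ i, |x i - y i|) :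
    ∃ θ : Fin D → ℝ, ‖θ‖ ≤ c ∧ ∀ x ∈ cube d a b,
      |scalarNet h0 h1 u v θ x - E x|
        ≤ 3 * d * Lip * (b - a) / (archMin l depth : ℝ) ^ (1 / (d : ℝ)) := by
  have hba : 0 < b - a := by linarith
  have hd' : (1 : ℝ) ≤ d := by exact_mod_cast hd
  have hA1 : (1 : ℝ) ≤ archMin l depth := by exact_mod_cast one_le_archMin hl
  set t : ℝ := (archMin l depth : ℝ) ^ (1 / (d : ℝ)) with ht
  have ht1 : 1 ≤ t := Real.one_le_rpow hA1 (by positivity)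
  have htd : t ^ d = archMin l depth := by
    rw [ht, ← Real.rpow_natCast, ← Real.rpow_mul (by positivity), one_div,
      inv_mul_cancel₀ (by positivity), Real.rpow_one]
  have hEc : ∀ x ∈ cube d a b, |E x| ≤ c := fun x hx =>
    (abs_le_max_abs_abs (hE x hx).1 (hE x hx).2).trans
      (max_le (by linarith [abs_nonneg u]) (by linarith [abs_nonneg v]))
  -- For `t ≤ 6` the constant network with the value of `E` at the center of the cube suffices: its
  -- error is at most `Lip * d * (b - a) / 2`.
  rcases le_or_gt t 6 with ht6 | ht6
  · have hmid : (fun _ => (a + b) / 2 : Fin d → ℝ) ∈ cube d a b :=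
      ⟨fun _ => by dsimp only; linarith, fun _ => by dsimp only; linarith⟩
    obtain ⟨θ, hθ, h⟩ := exists_scalarNet_const h0 h1 hdepth (by linarith) hD (hE _ hmid)
      (hEc _ hmid)
    refine ⟨θ, hθ, fun x hx => ?_⟩
    rw [h]
    refine (hEL _ hmid x hx).trans ?_
    have hs : ∑ i, |(a + b) / 2 - x i| ≤ ∑ _i : Fin d, (b - a) / 2 :=
      Finset.sum_le_sum fun i _ => abs_le.2
        ⟨by have := hx.2 i; dsimp only at this; linarith,
          by have := hx.1 i; dsimp only at this; linarith⟩
    simp only [Finset.sum_const, Finset.card_univ, Fintype.card_fin, nsmul_eq_mul] at hs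
    rw [le_div_iff₀ (by positivity)]
    calc (Lip * ∑ i, |(a + b) / 2 - x i|) * t ≤ Lip * (d * ((b - a) / 2)) * 6 := by
          gcongr
      _ = _ := by ring
  · subst h0
    -- Since `t > 6`, this `m` lies between `t / 3` and `t / 2`. The lower bound gives the accuracy;
    -- the upper bound gives `(2 * m) ^ d ≤ t ^ d = archMin l depth`, so that the tree fits into the
    -- network.
    set m : ℕ := ⌈t / 3⌉₊ with hm
    have hmt : t / 3 ≤ m := Nat.le_ceil _
    have hmt2 : (m : ℝ) ≤ t / 2 := by
      have := Nat.ceil_lt_add_one (a := t / 3) (by linarith)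
      linarith
    have hm1 : 1 ≤ m := Nat.one_le_ceil_iff.2 (by linarith)
    have hm' : (0 : ℝ) < m := by exact_mod_cast hm1
    have hmA : 2 * m ^ (l 0) ≤ archMin l depth := by
      have h2 : (2 * (m : ℝ)) ^ l 0 ≤ archMin l depth := by
        rw [← htd]; exact pow_le_pow_left₀ (by positivity) (by linarith) _
      have h3 : (2 * m) ^ l 0 ≤ archMin l depth := by exact_mod_cast h2
      rw [mul_pow] at h3
      exact (Nat.mul_le_mul_right _ (Nat.le_self_pow (by omega) 2)).trans h3
    have hA6 : 6 ≤ archMin l depth := by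
      have h2 : (6 : ℝ) ≤ archMin l depth := by
        rw [← htd]; exact ht6.le.trans (le_self_pow₀ ht1 (by omega))
      exact_mod_cast h2
    -- The distance layer fits because `d ≤ 6 ^ (d - 1) ≤ t ^ (d - 1)` and `2 * m ≤ t`.
    have hdm : 2 * (l 0 * m) ≤ archMin l depth := by
      have h2 : (l 0 : ℝ) ≤ t ^ (l 0 - 1) := by
        have h3 : l 0 ≤ 6 ^ (l 0 - 1) := by
          have := Nat.lt_pow_self (n := l 0 - 1) (a := 6) (by norm_num)
          omega
        have h4 : (l 0 : ℝ) ≤ 6 ^ (l 0 - 1) := by exact_mod_cast h3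
        exact h4.trans (pow_le_pow_left₀ (by norm_num) ht6.le _)
      have h5 : 2 * ((l 0 : ℝ) * m) ≤ archMin l depth := by
        rw [← htd]
        calc 2 * ((l 0 : ℝ) * m) = l 0 * (2 * m) := by ring
          _ ≤ t ^ (l 0 - 1) * t := by gcongr; linarith
          _ = t ^ l 0 := by rw [← pow_succ, Nat.sub_add_cancel hd]
      exact_mod_cast h5
    have hdep := archMin_le_pow l depth
    have hdepth4 : 3 ≤ depth := by
      by_contra! h
      have : 2 ^ (depth - 1) ≤ 2 ^ 1 := Nat.pow_le_pow_right (by norm_num) (by omega)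
      omega
    obtain ⟨k, rfl⟩ : ∃ k, depth = k + 2 := ⟨depth - 2, by omega⟩
    let g (j : Fin m) : ℝ := a + (b - a) * (2 * (j : ℕ) + 1) / (2 * m)
    have hg (j : Fin m) : g j ∈ Set.Icc a b := grid_mem hab j
    have hgc (q : Fin (l 0) → Fin m) : (fun i => g (q i)) ∈ cube (l 0) a b :=
      ⟨fun i => (hg _).1, fun i => (hg _).2⟩
    let V (q : Fin (l 0) → Fin m) (x : Fin (l 0) → ℝ) : ℝ :=
      E (fun i => g (q i)) - Lip * ∑ i, |x i - g (q i)|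
    have hV : Representable D l (k + 2) u v c 1 V :=
      representable_distances hc ((numParams_mono l (by omega)).trans hD) (by omega)
        (hdm.trans (archMin_le l le_rfl (by omega))) hLip hLc hcu hcv
        (fun j => (abs_le_max_abs_abs (hg j).1 (hg j).2).trans (max_le hca hcb))
        (fun q => hE _ (hgc q))
    have : Nonempty (Fin m) := ⟨⟨0, hm1⟩⟩
    obtain ⟨F, hF1, hF2⟩ : ∃ F : (Fin (l 0) → ℝ) → ℝ, (∀ x q, V q x ≤ F x) ∧
        ∀ x, ∃ q, V q x = F x :=
      ⟨fun x => Finset.univ.sup' Finset.univ_nonempty fun q => V q x,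
        fun x q => Finset.le_sup' (fun q => V q x) (Finset.mem_univ q), fun x => by
          obtain ⟨q, -, hq⟩ := Finset.exists_mem_eq_sup' Finset.univ_nonempty fun q => V q x
          exact ⟨q, hq.symm⟩⟩
    let e : Fin (m ^ l 0) ≃ (Fin (l 0) → Fin m) := (Fintype.equivFinOfCardEq (by simp)).symm
    -- One hidden layer computes the distances; the remaining `k = depth - 2` are enough for the
    -- tree, as `2 * m ^ d ≤ 2 ^ (depth - 1)`.
    have hR := exists_representable_of_max hc hD (fun i hi hi' => archMin_le l hi hi') hA6
      (Nat.one_le_pow _ _ hm1) hmA (fun x q => hF1 x (e q))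
      (fun x => by obtain ⟨q, hq⟩ := hF2 x; exact ⟨e.symm q, by simpa using hq⟩)
      (j := k) (by rw [Nat.add_sub_assoc (by norm_num), pow_succ] at hdep; omega) (by omega)
      (hV.comp e)
    rw [add_comm 1 k] at hR
    obtain ⟨θ, hθ, h⟩ := exists_scalarNet_eq_clip rfl h1 (by linarith) hD hR
    refine ⟨θ, hθ, fun x hx => ?_⟩
    rw [h]
    refine abs_clip_sub_le (hE x hx) ?_
    have hle : F x ≤ E x := by
      obtain ⟨q, hq⟩ := hF2 x
      have h2 := hEL _ (hgc q) x hx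
      rw [← hq]
      simp only [V]
      simp only [abs_sub_comm (x _)]
      linarith [(abs_le.1 h2).2]
    choose q hq using fun i => exists_grid_point hab hm1 ⟨hx.1 i, hx.2 i⟩
    have hs : ∑ i, |x i - g (q i)| ≤ ∑ _i : Fin (l 0), (b - a) / (2 * m) :=
      Finset.sum_le_sum fun i _ => hq i
    simp only [Finset.sum_const, Finset.card_univ, Fintype.card_fin, nsmul_eq_mul] at hs
    have hge : E x - 2 * (Lip * ∑ i, |x i - g (q i)|) ≤ F x := by
      have h2 := hEL x hx _ (hgc q)
      have h3 := hF1 x q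
      simp only [V] at h3
      linarith [(abs_le.1 h2).2]
    change |F x - E x| ≤ _
    rw [abs_sub_comm, abs_of_nonneg (by linarith), le_div_iff₀ (by positivity)]
    calc (E x - F x) * t ≤ 2 * (Lip * (l 0 * ((b - a) / (2 * m)))) * (3 * m) := by
          refine mul_le_mul ?_ (by linarith) (by positivity) (by positivity)
          have := mul_le_mul_of_nonneg_left hs hLip
          linarith
      _ = _ := by field_simp

end

/-! ### Moments from tails, maximal inequality, Hoeffding's inequality -/

section

lemma Gamma_le_one_of_mem_Icc {y : ℝ} (h1 : 1 ≤ y) (h2 : y ≤ 2) : Real.Gamma y ≤ 1 := by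
  have h := Real.convexOn_Gamma.le_max_of_mem_Icc (x := 1) (y := 2) (z := y)
    (by simp) (by simp) ⟨h1, h2⟩
  simpa [Real.Gamma_two] using h

/-- On `[1, 2]` convexity gives `Γ ≤ 1`; the recursion `Γ (1 + x) = x * Γ x` then extends the bound
one unit interval at a time. -/
lemma Gamma_one_add_le (x : ℝ) (hx : 0 ≤ x) : Real.Gamma (1 + x) ≤ max 1 x ^ x := by
  have key : ∀ n : ℕ, ∀ x : ℝ, 0 ≤ x → x ≤ n + 1 → Real.Gamma (1 + x) ≤ max 1 x ^ x := by
    intro n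
    induction n with
    | zero =>
      intro x hx hx1
      exact (Gamma_le_one_of_mem_Icc (by linarith) (by norm_num at hx1; linarith)).trans
        (Real.one_le_rpow (le_max_left _ _) hx)
    | succ n ih =>
      intro x hx hxn
      push_cast at hxn
      rcases le_or_gt x 1 with h | h
      · exact (Gamma_le_one_of_mem_Icc (by linarith) (by linarith)).trans
          (Real.one_le_rpow (le_max_left _ _) hx)
      · have h1 := ih (x - 1) (by linarith) (by linarith)
        rw [add_sub_cancel] at h1
        rw [add_comm, Real.Gamma_add_one (by linarith), max_eq_right h.le]
        have h2 : max 1 (x - 1) ^ (x - 1) ≤ x ^ (x - 1) :=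
          Real.rpow_le_rpow (by positivity) (max_le h.le (by linarith)) (by linarith)
        calc x * Real.Gamma x ≤ x * x ^ (x - 1) :=
              mul_le_mul_of_nonneg_left (h1.trans h2) (by linarith)
          _ = x ^ x := by
              rw [← Real.rpow_one_add' (by linarith) (by linarith)]; congr 1; ring
  obtain ⟨n, hn⟩ := exists_nat_ge x
  exact key n x hx (by linarith)

variable {Ω : Type*} [MeasurableSpace Ω] {P : Measure Ω}

/-- The layer-cake formula, with the tail bound inserted, leaves a Gamma integral. -/
lemma lintegral_rpow_le_of_tail {f : Ω → ℝ} (hf0 : ∀ ω, 0 ≤ f ω) (hf : Measurable f)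
    {C κ γ s : ℝ} (hC : 0 ≤ C) (hκ : 0 < κ) (hγ : 0 < γ) (hs : 0 < s)
    (htail : ∀ t > 0, P {ω | t < f ω} ≤ ENNReal.ofReal (C * Real.exp (-κ * t ^ γ))) :
    ∫⁻ ω, ENNReal.ofReal (f ω) ^ s ∂P
      ≤ ENNReal.ofReal (C * (κ ^ (-s / γ) * Real.Gamma (1 + s / γ))) := by
  have hint : IntegrableOn (fun t : ℝ => t ^ (s - 1) * Real.exp (-κ * t ^ γ)) (Set.Ioi 0) :=
    integrableOn_rpow_mul_exp_neg_mul_rpow (by linarith) hγ hκ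
  have hval := integral_rpow_mul_exp_neg_mul_rpow (q := s - 1) hγ (by linarith) hκ
  simp only [sub_add_cancel] at hval
  have h1 : ∫⁻ ω, ENNReal.ofReal (f ω) ^ s ∂P = ∫⁻ ω, ENNReal.ofReal (f ω ^ s) ∂P :=
    lintegral_congr fun ω => ENNReal.ofReal_rpow_of_nonneg (hf0 ω) hs.le
  rw [h1, lintegral_rpow_eq_lintegral_meas_lt_mul P (Filter.Eventually.of_forall hf0)
    hf.aemeasurable hs]
  have h2 : ∫⁻ t in Set.Ioi (0 : ℝ), P {ω | t < f ω} * ENNReal.ofReal (t ^ (s - 1))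
      ≤ ∫⁻ t in Set.Ioi (0 : ℝ),
        ENNReal.ofReal (C * (t ^ (s - 1) * Real.exp (-κ * t ^ γ))) := by
    refine setLIntegral_mono' measurableSet_Ioi fun t ht => ?_
    refine (mul_le_mul_left (htail t ht) _).trans (le_of_eq ?_)
    rw [← ENNReal.ofReal_mul (by positivity)]
    congr 1
    ring
  refine (mul_le_mul_right h2 _).trans (le_of_eq ?_)
  rw [← ofReal_integral_eq_lintegral_ofReal (hint.const_mul C)
    ((ae_restrict_iff' measurableSet_Ioi).2 (Filter.Eventually.of_forall fun t ht => by
      have : (0 : ℝ) < t := ht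
      dsimp only
      positivity)), integral_const_mul, hval, ← ENNReal.ofReal_mul hs.le, add_comm 1 (s / γ),
    Real.Gamma_add_one (by positivity)]
  congr 1
  field_simp

/-- Moments of a random variable whose tails are bounded by `C * exp (-(t / σ) ^ γ)`. -/
lemma lp_le_of_tail {f : Ω → ℝ} (hf0 : ∀ ω, 0 ≤ f ω) (hf : Measurable f)
    {C σ γ s : ℝ} (hC : 0 ≤ C) (hσ : 0 < σ) (hγ : 0 < γ) (hs : 0 < s)
    (htail : ∀ t > 0, P {ω | t < f ω} ≤ ENNReal.ofReal (C * Real.exp (-(t / σ) ^ γ))) :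
    (∫⁻ ω, ENNReal.ofReal (f ω) ^ s ∂P) ^ (1 / s)
      ≤ ENNReal.ofReal (σ * C ^ (1 / s) * max 1 (s / γ) ^ (1 / γ)) := by
  have h := lintegral_rpow_le_of_tail (P := P) hf0 hf hC (κ := σ ^ (-γ)) (by positivity) hγ hs
    (fun t ht => (htail t ht).trans (le_of_eq (by
      rw [Real.div_rpow ht.le hσ.le, Real.rpow_neg hσ.le]
      congr 3
      field_simp)))
  have hg := Gamma_one_add_le (s / γ) (by positivity)
  have hm : (0 : ℝ) < max 1 (s / γ) := lt_max_of_lt_left one_pos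
  have h2 : C * ((σ ^ (-γ)) ^ (-s / γ) * Real.Gamma (1 + s / γ))
      ≤ (σ * C ^ (1 / s) * max 1 (s / γ) ^ (1 / γ)) ^ s := by
    rw [Real.mul_rpow (by positivity) (by positivity), Real.mul_rpow hσ.le (by positivity),
      ← Real.rpow_mul hC, ← Real.rpow_mul hm.le, one_div_mul_cancel hs.ne', Real.rpow_one,
      ← Real.rpow_mul hσ.le, show -γ * (-s / γ) = s by field_simp,
      show 1 / γ * s = s / γ by ring]
    calc C * (σ ^ s * Real.Gamma (1 + s / γ)) ≤ C * (σ ^ s * max 1 (s / γ) ^ (s / γ)) := by gcongr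
      _ = _ := by ring
  refine (ENNReal.rpow_le_rpow (h.trans (ENNReal.ofReal_le_ofReal h2)) (by positivity)).trans ?_
  rw [ENNReal.ofReal_rpow_of_nonneg (by positivity) (by positivity),
    ← Real.rpow_mul (by positivity), mul_one_div_cancel hs.ne', Real.rpow_one]

lemma lp_mono [IsProbabilityMeasure P] {f : Ω → ENNReal} (hf : Measurable f) {r s : ℝ}
    (hr : 0 < r) (hrs : r ≤ s) :
    (∫⁻ ω, f ω ^ r ∂P) ^ (1 / r) ≤ (∫⁻ ω, f ω ^ s ∂P) ^ (1 / s) := by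
  have h := eLpNorm'_le_eLpNorm'_of_exponent_le hr hrs P hf.aestronglyMeasurable
  simpa [eLpNorm'] using h

/-- Maximal inequality for finitely many sub-Gaussian random variables. -/
lemma lp_sup_le_of_tail [IsProbabilityMeasure P] {ι : Type*} [Fintype ι] [Nonempty ι]
    {U : ι → Ω → ℝ} (hU : ∀ i, Measurable (U i)) {σ q s : ℝ} (hσ : 0 < σ)
    (htail : ∀ i, ∀ t > 0, P {ω | t < |U i ω|} ≤ ENNReal.ofReal (2 * Real.exp (-(t / σ) ^ (2 : ℝ))))
    (hq : 0 < q) (hqs : q ≤ s) (hs2 : 2 ≤ s) (hs : Real.log (2 * Fintype.card ι) ≤ s) :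
    (∫⁻ ω, ENNReal.ofReal (Finset.univ.sup' Finset.univ_nonempty fun i => |U i ω|) ^ q ∂P)
      ^ (1 / q) ≤ ENNReal.ofReal (σ * Real.exp 1 * (s / 2) ^ (1 / 2 : ℝ)) := by
  have hmeas : Measurable fun ω => Finset.univ.sup' Finset.univ_nonempty fun i => |U i ω| := by
    convert Finset.measurable_sup' (s := Finset.univ) (Finset.univ_nonempty (α := ι))
      (f := fun i ω => |U i ω|) fun i _ => (hU i).abs using 1
    ext ω
    simp
  -- Raising the exponent to `s ≥ log (2 * card ι)` makes the factor from the union bound harmless: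
  -- `(2 * card ι) ^ (1 / s) ≤ e`.
  refine (lp_mono hmeas.ennreal_ofReal hq hqs).trans ?_
  have hcard : (0 : ℝ) < Fintype.card ι := by exact_mod_cast Fintype.card_pos
  refine (lp_le_of_tail (P := P) (C := 2 * Fintype.card ι) (σ := σ) (γ := 2) (s := s) (fun ω => ?_)
    hmeas (by positivity) hσ two_pos (by linarith) fun t ht => ?_).trans ?_
  · obtain ⟨i⟩ := ‹Nonempty ι›
    exact (abs_nonneg _).trans (Finset.le_sup' (fun i => |U i ω|) (Finset.mem_univ i))
  · have h : {ω | t < Finset.univ.sup' Finset.univ_nonempty fun i => |U i ω|}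
        = ⋃ i, {ω | t < |U i ω|} := by
      ext ω
      simp
    rw [h]
    refine (measure_iUnion_fintype_le _ _).trans
      ((Finset.sum_le_sum fun i _ => htail i t ht).trans (le_of_eq ?_))
    rw [Finset.sum_const, Finset.card_univ, nsmul_eq_mul, ← ENNReal.ofReal_natCast,
      ← ENNReal.ofReal_mul (by positivity)]
    congr 1
    ring
  · refine ENNReal.ofReal_le_ofReal ?_
    rw [max_eq_right (by linarith)]
    have h : (2 * (Fintype.card ι : ℝ)) ^ (1 / s) ≤ Real.exp 1 := by
      rw [Real.rpow_def_of_pos (by positivity), mul_one_div]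
      exact Real.exp_le_exp.2 ((div_le_one (by linarith)).2 hs)
    gcongr

/-- Hoeffding's inequality for the mean of bounded random variables. -/
lemma measure_abs_mean_sub_gt_le [IsProbabilityMeasure P] {M : ℕ} (hM : 1 ≤ M)
    {ξ : ℕ → Ω → ℝ} (hm : ∀ j ∈ Set.Icc 1 M, Measurable (ξ j)) {R r : ℝ} (hR : 0 < R)
    (hξ : ∀ j ∈ Set.Icc 1 M, ∀ ω, ξ j ω ∈ Set.Icc 0 R)
    (hind : iIndepFun (fun (j : Set.Icc 1 M) => ξ j) P) (hr : ∀ j ∈ Set.Icc 1 M, ∫ ω, ξ j ω ∂P = r)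
    {t : ℝ} (ht : 0 < t) :
    P {ω | t < |1 / (M : ℝ) * ∑ j ∈ Finset.Icc 1 M, ξ j ω - r|}
      ≤ ENNReal.ofReal (2 * Real.exp (-(t / (R / (2 * M) ^ (1 / 2 : ℝ))) ^ (2 : ℝ))) := by
  have hM' : (0 : ℝ) < M := by exact_mod_cast hM
  let η (j : Set.Icc 1 M) (ω : Ω) : ℝ := ξ j ω - r
  have hsub : ∀ j : Set.Icc 1 M, HasSubgaussianMGF (η j) ((‖R - 0‖₊ / 2) ^ 2) P := by
    intro j
    have h := hasSubgaussianMGF_of_mem_Icc (μ := P) (hm j j.2).aemeasurable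
      (Filter.Eventually.of_forall (hξ j j.2))
    rwa [hr j j.2] at h
  have hind' : iIndepFun η P := hind.comp (fun _ x => x - r) fun _ => by fun_prop
  have hind'' : iIndepFun (fun j ω => -η j ω) P := hind'.comp (fun _ x => -x) fun _ => by fun_prop
  have hcard : Fintype.card (Set.Icc 1 M) = M := by simp
  have hsum (ω : Ω) : 1 / (M : ℝ) * ∑ j ∈ Finset.Icc 1 M, ξ j ω - r
      = 1 / (M : ℝ) * ∑ j : Set.Icc 1 M, η j ω := by
    have h : ∑ j ∈ Finset.Icc 1 M, ξ j ω = ∑ j : Set.Icc 1 M, ξ j ω :=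
      Finset.sum_subtype _ (fun x => by simp) _
    simp only [η]
    rw [Finset.sum_sub_distrib, h, Finset.sum_const, Finset.card_univ, hcard, nsmul_eq_mul]
    field_simp
  -- Each summand has variance proxy `(R / 2) ^ 2`, so both exponents equal `-2 * M * t ^ 2 / R ^
  -- 2`.
  have hexp : Real.exp (-(M * t) ^ 2 / (2 * ((∑ _j : Set.Icc 1 M, (‖R - 0‖₊ / 2) ^ 2 : NNReal) : ℝ)))
      = Real.exp (-(t / (R / (2 * M) ^ (1 / 2 : ℝ))) ^ (2 : ℝ)) := by
    congr 1
    have h2 : (((2 : ℝ) * M) ^ (1 / 2 : ℝ)) ^ 2 = 2 * M := by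
      rw [← Real.rpow_natCast, ← Real.rpow_mul (by positivity)]
      norm_num
    rw [Real.rpow_two, div_pow t, div_pow R, h2, Finset.sum_const, Finset.card_univ, hcard]
    simp only [sub_zero, nsmul_eq_mul, NNReal.coe_mul, NNReal.coe_natCast, NNReal.coe_pow,
      NNReal.coe_div, coe_nnnorm, Real.norm_eq_abs, abs_of_pos hR, NNReal.coe_ofNat]
    field_simp
  have hMt : 0 ≤ M * t := by positivity
  have h1 := HasSubgaussianMGF.measure_sum_ge_le_of_iIndepFun hind' (s := Finset.univ)
    (fun j _ => hsub j) hMt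
  have h2 := HasSubgaussianMGF.measure_sum_ge_le_of_iIndepFun hind'' (s := Finset.univ)
    (fun j _ => (hsub j).neg) hMt
  rw [hexp] at h1 h2
  have hset : {ω | t < |1 / (M : ℝ) * ∑ j ∈ Finset.Icc 1 M, ξ j ω - r|}
      ⊆ {ω | M * t ≤ ∑ j, η j ω} ∪ {ω | M * t ≤ ∑ j, -η j ω} := by
    intro ω hω
    simp only [Set.mem_ofPred_eq, hsum, Set.mem_union, Finset.sum_neg_distrib] at hω ⊢
    rw [abs_mul, abs_of_pos (by positivity), one_div, ← div_eq_inv_mul, lt_div_iff₀ hM'] at hω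
    rcases lt_abs.1 hω with h | h
    · left; linarith
    · right; linarith
  refine (measure_mono hset).trans ((measure_union_le _ _).trans ?_)
  rw [two_mul, ENNReal.ofReal_add (by positivity) (by positivity)]
  refine add_le_add ?_ ?_
  · exact (ENNReal.le_ofReal_iff_toReal_le (measure_ne_top _ _) (by positivity)).2 h1
  · exact (ENNReal.le_ofReal_iff_toReal_le (measure_ne_top _ _) (by positivity)).2 h2

end

/-! ### Best random initialization; bias-variance decomposition -/

section

/-- The maximum distance of the first `n` coordinates. -/
def paramDist {D : ℕ} (n : ℕ) (θ θ' : Fin D → ℝ) : ℝ :=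
  ‖fun i : Fin n => coord θ i - coord θ' i‖

lemma continuous_paramDist {D : ℕ} (n : ℕ) (θ' : Fin D → ℝ) :
    Continuous fun θ => paramDist n θ θ' :=
  continuous_norm.comp (continuous_pi fun _ => (continuous_coord _).sub continuous_const)

lemma abs_coord_sub_le_paramDist {D n : ℕ} (θ θ' : Fin D → ℝ) {q : ℕ} (hq : q < n) :
    |coord θ q - coord θ' q| ≤ paramDist n θ θ' :=
  norm_le_pi_norm (fun i : Fin n => coord θ i - coord θ' i) ⟨q, hq⟩

lemma paramDist_nonneg {D n : ℕ} (θ θ' : Fin D → ℝ) : 0 ≤ paramDist n θ θ' := norm_nonneg _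

lemma norm_le_of_mem_cube {D : ℕ} {c : ℝ} (hc : 0 ≤ c) {θ : Fin D → ℝ}
    (hθ : θ ∈ cube D (-c) c) : ‖θ‖ ≤ c :=
  (pi_norm_le_iff_of_nonneg hc).2 fun i => abs_le.2 ⟨hθ.1 i, hθ.2 i⟩

variable {Ω : Type*} [MeasurableSpace Ω] {P : Measure Ω}

lemma volume_cube {D : ℕ} {c : ℝ} (hc : 0 ≤ c) :
    volume (cube D (-c) c) = ENNReal.ofReal ((2 * c) ^ D) := by
  rw [cube, Real.volume_Icc_pi, ENNReal.ofReal_pow (by positivity)]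
  simp [two_mul]

lemma ae_mem_cube_of_isUniform {D : ℕ} {c : ℝ} (hc : 0 < c) {T : Ω → Fin D → ℝ}
    (hu : pdf.IsUniform T (cube D (-c) c) P volume) :
    ∀ᵐ ω ∂P, T ω ∈ cube D (-c) c := by
  have h0 : volume (cube D (-c) c) ≠ 0 := by
    rw [volume_cube hc.le]; simp; positivity
  have h1 : volume (cube D (-c) c) ≠ ⊤ := by rw [volume_cube hc.le]; simp
  have h := hu.measure_preimage h0 h1 (measurableSet_Icc (a := fun _ => -c) (b := fun _ => c)).compl
  change P (T ⁻¹' (cube D (-c) c)ᶜ) = volume (cube D (-c) c ∩ (cube D (-c) c)ᶜ) / _ at h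
  rw [Set.inter_compl_self, measure_empty, ENNReal.zero_div] at h
  exact h

/-- Even if `θ` is a corner of the cube, the interval of radius `t` around each coordinate meets
`[-c, c]` in length at least `min t (2 * c)`. With `r = min (t / (2 * c)) 1`, a miss has probability
at most `1 - r ^ n`, which is at most the exponential by `1 + x ≤ exp x` if `r < 1` and is zero if
`r = 1`. -/
lemma measure_paramDist_gt_le [IsProbabilityMeasure P] {D n : ℕ} (hnD : n ≤ D)
    {c : ℝ} (hc : 0 < c) {T : Ω → Fin D → ℝ} (hT : Measurable T)
    (hu : pdf.IsUniform T (cube D (-c) c) P volume) {θ : Fin D → ℝ} (hθ : ‖θ‖ ≤ c)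
    {t : ℝ} (ht : 0 < t) :
    P {ω | t < paramDist n (T ω) θ} ≤ ENNReal.ofReal (Real.exp (-(t / (2 * c)) ^ (n : ℝ))) := by
  have h0 : volume (cube D (-c) c) ≠ 0 := by
    rw [volume_cube hc.le]; simp; positivity
  have h1 : volume (cube D (-c) c) ≠ ⊤ := by rw [volume_cube hc.le]; simp
  set r : ℝ := min (t / (2 * c)) 1 with hr
  have hr0 : 0 < r := lt_min (by positivity) one_pos
  have hr1 : r ≤ 1 := min_le_right _ _
  have hrt : 2 * c * r ≤ t := by
    have := min_le_left (t / (2 * c)) 1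
    rw [← hr, le_div_iff₀ (by positivity)] at this
    linarith
  let lo (i : Fin D) : ℝ := if (i : ℕ) < n then max (-c) (θ i - t) else -c
  let hi (i : Fin D) : ℝ := if (i : ℕ) < n then min c (θ i + t) else c
  have hθi (i : Fin D) : -c ≤ θ i ∧ θ i ≤ c := abs_le.1 ((norm_le_pi_norm θ i).trans hθ)
  have hlen (i : Fin D) : 2 * c * (if (i : ℕ) < n then r else 1) ≤ hi i - lo i := by
    simp only [lo, hi]
    split_ifs
    · have h2 : 2 * c * r ≤ 2 * c := mul_le_of_le_one_right (by positivity) hr1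
      have := hθi i
      rcases max_cases (-c) (θ i - t) with ⟨e1, _⟩ | ⟨e1, _⟩ <;>
        rcases min_cases c (θ i + t) with ⟨e2, _⟩ | ⟨e2, _⟩ <;> rw [e1, e2] <;> linarith
    · linarith
  have hsub : Set.Icc lo hi ⊆ cube D (-c) c := by
    refine Set.Icc_subset_Icc (fun i => ?_) fun i => ?_
    · simp only [lo]
      split_ifs
      · exact le_max_left _ _
      · exact le_rfl
    · simp only [hi]
      split_ifs
      · exact min_le_left _ _
      · exact le_rfl
  have hprod : ENNReal.ofReal ((2 * c) ^ D * r ^ n) ≤ volume (Set.Icc lo hi) := by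
    rw [Real.volume_Icc_pi, ← ENNReal.ofReal_prod_of_nonneg fun i _ =>
      le_trans (by positivity) (hlen i)]
    refine ENNReal.ofReal_le_ofReal ((le_of_eq ?_).trans
      (Finset.prod_le_prod (fun i _ => by positivity) fun i _ => hlen i))
    have hcard : (Finset.univ.filter fun i : Fin D => (i : ℕ) < n).card = n := by
      rw [Fin.card_filter_val_lt]; omega
    rw [Finset.prod_mul_distrib, Finset.prod_ite]
    simp [hcard]
  have hball : ENNReal.ofReal (r ^ n) ≤ P (T ⁻¹' Set.Icc lo hi) := by
    rw [hu.measure_preimage h0 h1 measurableSet_Icc, Set.inter_eq_right.2 hsub,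
      ENNReal.le_div_iff_mul_le (Or.inl h0) (Or.inl h1), volume_cube hc.le,
      ← ENNReal.ofReal_mul (by positivity), mul_comm]
    exact hprod
  have hcompl : {ω | t < paramDist n (T ω) θ} ⊆ (T ⁻¹' Set.Icc lo hi)ᶜ := by
    intro ω hω hmem
    refine absurd hω (not_lt.2 ((pi_norm_le_iff_of_nonneg ht.le).2 fun i => ?_))
    have hi' : (i : ℕ) < D := i.2.trans_le hnD
    have h2 := hmem.1 ⟨i, hi'⟩
    have h3 := hmem.2 ⟨i, hi'⟩
    simp only [lo, hi, i.2, if_true] at h2 h3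
    simp only [coord, hi', dif_pos, Real.norm_eq_abs]
    exact abs_le.2 ⟨by linarith [(le_max_right _ _).trans h2],
      by linarith [h3.trans (min_le_right _ _)]⟩
  refine (measure_mono hcompl).trans ?_
  rw [prob_compl_eq_one_sub (hT measurableSet_Icc)]
  refine (tsub_le_tsub_left hball 1).trans ?_
  rw [← ENNReal.ofReal_one, ← ENNReal.ofReal_sub _ (by positivity)]
  refine ENNReal.ofReal_le_ofReal ?_
  rw [Real.rpow_natCast]
  rcases min_cases (t / (2 * c)) 1 with ⟨e, _⟩ | ⟨e, _⟩
  · rw [hr, e]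
    linarith [Real.add_one_le_exp (-(t / (2 * c)) ^ n)]
  · rw [hr, e, one_pow, sub_self]
    positivity

/-- The best of `K` independent uniformly distributed random initializations. -/
lemma lp_inf_paramDist_le [IsProbabilityMeasure P] {D n K : ℕ} (hn : 1 ≤ n) (hnD : n ≤ D)
    (hK : 1 ≤ K) {c : ℝ} (hc : 0 < c) {T : ℕ → Ω → Fin D → ℝ} (hT : ∀ k, Measurable (T k))
    (hind : iIndepFun (fun (k : Set.Icc 1 K) => T k) P)
    (hident : ∀ k ∈ Set.Icc 1 K, IdentDistrib (T k) (T 1) P P)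
    (hu : pdf.IsUniform (T 1) (cube D (-c) c) P volume) {θ : Fin D → ℝ} (hθ : ‖θ‖ ≤ c)
    {s : ℝ} (hs : 1 ≤ s) :
    (∫⁻ ω, ENNReal.ofReal ((Finset.Icc 1 K).inf' (Finset.nonempty_Icc.2 hK)
        fun k => paramDist n (T k ω) θ) ^ s ∂P) ^ (1 / s)
      ≤ ENNReal.ofReal (2 * c * (K : ℝ) ^ (-1 / (n : ℝ)) * s) := by
  have hn' : (1 : ℝ) ≤ n := by exact_mod_cast hn
  have hK' : (0 : ℝ) < K := by exact_mod_cast hK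
  have hmeas : Measurable fun ω => (Finset.Icc 1 K).inf' (Finset.nonempty_Icc.2 hK)
      fun k => paramDist n (T k ω) θ := by
    convert Finset.inf'_induction (s := Finset.Icc 1 K) (Finset.nonempty_Icc.2 hK)
      (fun k ω => paramDist n (T k ω) θ) (p := Measurable) (fun _ h _ h' => h.inf h')
      fun k _ => (continuous_paramDist n θ).measurable.comp (hT k) using 1
    ext ω
    simp
  refine (lp_le_of_tail (P := P) (C := 1) (σ := 2 * c * (K : ℝ) ^ (-1 / (n : ℝ))) (γ := n)
    (fun ω => Finset.le_inf' _ _ fun k _ => paramDist_nonneg _ _)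
    hmeas zero_le_one (by positivity) (by positivity) (by linarith) fun t ht => ?_).trans ?_
  · have hset : {ω | t < (Finset.Icc 1 K).inf' (Finset.nonempty_Icc.2 hK)
        fun k => paramDist n (T k ω) θ}
        = ⋂ k ∈ (Finset.univ : Finset (Set.Icc 1 K)), T k ⁻¹' {x | t < paramDist n x θ} := by
      ext ω
      simp
    have hms : MeasurableSet {x : Fin D → ℝ | t < paramDist n x θ} :=
      measurableSet_lt measurable_const (continuous_paramDist n θ).measurable
    rw [hset, hind.measure_inter_preimage_eq_mul Finset.univ fun _ _ => hms]
    refine (Finset.prod_le_prod' (g := fun _ =>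
      ENNReal.ofReal (Real.exp (-(t / (2 * c)) ^ (n : ℝ)))) fun k _ => ?_).trans (le_of_eq ?_)
    · rw [(hident k k.2).measure_preimage_eq hms]
      exact measure_paramDist_gt_le hnD hc (hT 1) hu hθ ht
    · rw [Finset.prod_const, Finset.card_univ, ← ENNReal.ofReal_pow (by positivity),
        ← Real.exp_nat_mul, one_mul]
      -- The `K` independent tails multiply, and the factor `K` in the exponent is absorbed into the
      -- scale as `K ^ (-1 / n)`.
      congr 2
      have hpow : ((K : ℝ) ^ (-1 / (n : ℝ))) ^ (n : ℝ) = (K : ℝ)⁻¹ := by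
        rw [← Real.rpow_mul hK'.le, div_mul_cancel₀ _ (by positivity), Real.rpow_neg_one]
      rw [← div_div t (2 * c), Real.div_rpow (x := t / (2 * c)) (by positivity)
        (by positivity), hpow]
      simp only [Fintype.card_ofFinset, Nat.card_Icc, Nat.add_sub_cancel]
      simp
      ring
  · refine ENNReal.ofReal_le_ofReal ?_
    rw [Real.one_rpow, mul_one]
    refine mul_le_mul_of_nonneg_left ?_ (by positivity)
    have h1 : max 1 (s / n) ≤ s := max_le hs (div_le_self (by linarith) hn')
    calc max 1 (s / n) ^ (1 / (n : ℝ)) ≤ s ^ (1 / (n : ℝ)) :=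
          Real.rpow_le_rpow (by positivity) h1 (by positivity)
      _ ≤ s ^ (1 : ℝ) := Real.rpow_le_rpow_of_exponent_le hs ((div_le_one (by positivity)).2 hn')
      _ = s := Real.rpow_one s

/-- The bias-variance decomposition. -/
lemma integral_sq_sub_condExp {Ω : Type*} {m m0 : MeasurableSpace Ω} {P : Measure Ω} [IsProbabilityMeasure P]
    (hm : m ≤ m0) {F G Y : Ω → ℝ} {u v : ℝ} (hF : StronglyMeasurable[m] F)
    (hFm : ∀ ω, F ω ∈ Set.Icc u v) (hG : G =ᵐ[P] P[Y | m]) (hGm : ∀ ω, G ω ∈ Set.Icc u v)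
    (hY : Measurable Y) (hYm : ∀ ω, Y ω ∈ Set.Icc u v) :
    ∫ ω, |F ω - G ω| ^ 2 ∂P = ∫ ω, |F ω - Y ω| ^ 2 ∂P - ∫ ω, |G ω - Y ω| ^ 2 ∂P := by
  have hFa : AEStronglyMeasurable F P := (hF.mono hm).aestronglyMeasurable
  have hYa : AEStronglyMeasurable Y P := hY.aestronglyMeasurable
  have hGa : AEStronglyMeasurable G P :=
    (stronglyMeasurable_condExp.mono hm).aestronglyMeasurable.congr hG.symm
  have hdiff {a b : ℝ} (ha : a ∈ Set.Icc u v) (hb : b ∈ Set.Icc u v) : |a - b| ≤ v - u :=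
    abs_sub_le_iff.2 ⟨by linarith [ha.2, hb.1], by linarith [ha.1, hb.2]⟩
  have hint {A B C' D' : Ω → ℝ} (hA : AEStronglyMeasurable A P) (hB : AEStronglyMeasurable B P)
      (hC : AEStronglyMeasurable C' P) (hD : AEStronglyMeasurable D' P)
      (hAm : ∀ ω, A ω ∈ Set.Icc u v) (hBm : ∀ ω, B ω ∈ Set.Icc u v)
      (hCm : ∀ ω, C' ω ∈ Set.Icc u v) (hDm : ∀ ω, D' ω ∈ Set.Icc u v) :
      Integrable (fun ω => (A ω - B ω) * (C' ω - D' ω)) P := by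
    refine Integrable.of_bound ((hA.sub hB).mul (hC.sub hD)) ((v - u) * (v - u))
      (Filter.Eventually.of_forall fun ω => ?_)
    rw [norm_mul]
    exact mul_le_mul (hdiff (hAm ω) (hBm ω)) (hdiff (hCm ω) (hDm ω)) (abs_nonneg _)
      ((abs_nonneg _).trans (hdiff (hAm ω) (hBm ω)))
  have hYint : Integrable Y P := Integrable.of_mem_Icc u v hY.aemeasurable
    (Filter.Eventually.of_forall hYm)
  -- `G` agrees with the conditional expectation only almost everywhere; `H` is the version of `F -
  -- G` that is measurable for `m`, as pulling it out of the conditional expectation requires.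
  set H : Ω → ℝ := fun ω => F ω - (P[Y | m]) ω with hH
  have hHm : StronglyMeasurable[m] H := hF.sub stronglyMeasurable_condExp
  have hHG : H =ᵐ[P] fun ω => F ω - G ω := by
    filter_upwards [hG] with ω hω
    rw [hH, hω]
  have hHb : ∀ᵐ ω ∂P, ‖H ω‖ ≤ v - u := by
    filter_upwards [hHG] with ω hω
    rw [hω]
    exact hdiff (hFm ω) (hGm ω)
  have hHY : Integrable (H * Y) P :=
    hYint.bdd_mul (hHm.mono hm).aestronglyMeasurable hHb
  have hcross : ∫ ω, (F ω - G ω) * (G ω - Y ω) ∂P = 0 := by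
    have h1 := condExp_mul_of_stronglyMeasurable_left hHm hHY hYint
    have h2 : ∫ ω, (H * P[Y | m]) ω ∂P = ∫ ω, (H * Y) ω ∂P := by
      rw [← integral_congr_ae h1, integral_condExp hm]
    have h3 : Integrable (H * P[Y | m]) P :=
      integrable_condExp.bdd_mul (hHm.mono hm).aestronglyMeasurable hHb
    rw [← sub_eq_zero, ← integral_sub h3 hHY] at h2
    rw [← h2]
    refine integral_congr_ae ?_
    filter_upwards [hG] with ω hω
    simp only [Pi.mul_apply, hH, hω]
    ring
  have i1 := hint hFa hGa hFa hGa hFm hGm hFm hGm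
  have i2 := hint hGa hYa hGa hYa hGm hYm hGm hYm
  have i3 := hint hFa hGa hGa hYa hFm hGm hGm hYm
  have e : ∫ ω, |F ω - Y ω| ^ 2 ∂P = ∫ ω, ((F ω - G ω) * (F ω - G ω)
      + (G ω - Y ω) * (G ω - Y ω) + 2 * ((F ω - G ω) * (G ω - Y ω))) ∂P := by
    congr 1
    ext ω
    rw [sq_abs]
    ring
  have e2 := integral_add (i1.add i2) (i3.const_mul 2)
  simp only [Pi.add_apply] at e2
  rw [e, e2, integral_add i1 i2, integral_const_mul, hcross]
  have hsq (x : ℝ) : |x| ^ 2 = x * x := by rw [sq_abs, sq]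
  simp only [hsq]
  ring

end

/-! ### Perturbation of risks, covering of the parameter cube, numerical estimates -/

section

lemma abs_sub_le_of_mem_Icc {u v x y : ℝ} (hx : x ∈ Set.Icc u v) (hy : y ∈ Set.Icc u v) :
    |x - y| ≤ v - u :=
  abs_sub_le_iff.2 ⟨by linarith [hx.2, hy.1], by linarith [hx.1, hy.2]⟩

lemma sq_abs_sub_mem_Icc {u v x y : ℝ} (hx : x ∈ Set.Icc u v) (hy : y ∈ Set.Icc u v) :
    |x - y| ^ 2 ∈ Set.Icc 0 ((v - u) ^ 2) :=
  ⟨by positivity, pow_le_pow_left₀ (abs_nonneg _) (abs_sub_le_of_mem_Icc hx hy) 2⟩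

lemma abs_sq_sub_sq_le {u v x x' y ε : ℝ} (hx : x ∈ Set.Icc u v) (hx' : x' ∈ Set.Icc u v)
    (hy : y ∈ Set.Icc u v) (h : |x - x'| ≤ ε) :
    |(|x - y| ^ 2 - |x' - y| ^ 2)| ≤ 2 * (v - u) * ε := by
  have e : |x - y| ^ 2 - |x' - y| ^ 2 = ((x - y) + (x' - y)) * (x - x') := by
    rw [sq_abs, sq_abs]; ring
  rw [e, abs_mul]
  refine mul_le_mul ((abs_add_le _ _).trans ?_) h (abs_nonneg _) (by linarith [hx.1, hx.2])
  linarith [abs_sub_le_of_mem_Icc hx hy, abs_sub_le_of_mem_Icc hx' hy]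

lemma abs_empiricalRisk_sub_le {d M : ℕ} (hM : 1 ≤ M) {F F' : (Fin d → ℝ) → ℝ}
    {x : ℕ → Fin d → ℝ} {y : ℕ → ℝ} {u v ε : ℝ} (hF : ∀ z, F z ∈ Set.Icc u v)
    (hF' : ∀ z, F' z ∈ Set.Icc u v) (hy : ∀ j ∈ Set.Icc 1 M, y j ∈ Set.Icc u v)
    (h : ∀ j ∈ Set.Icc 1 M, |F (x j) - F' (x j)| ≤ ε) :
    |empiricalRisk M F x y - empiricalRisk M F' x y| ≤ 2 * (v - u) * ε := by
  have hM' : (0 : ℝ) < M := by exact_mod_cast hM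
  unfold empiricalRisk
  rw [← mul_sub, ← Finset.sum_sub_distrib, abs_mul, abs_of_pos (by positivity), one_div,
    ← div_eq_inv_mul, div_le_iff₀ hM']
  refine (Finset.abs_sum_le_sum_abs _ _).trans ((Finset.sum_le_sum fun j hj =>
    abs_sq_sub_sq_le (hF _) (hF' _) (hy j (Finset.mem_Icc.1 hj)) (h j (Finset.mem_Icc.1 hj))).trans
    (le_of_eq ?_))
  simp
  ring

lemma lp_const_mul {Ω : Type*} [MeasurableSpace Ω] {P : Measure Ω} {f : Ω → ENNReal} (hf : Measurable f) {s : ℝ} (hs : 0 < s) (C : ENNReal) :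
    (∫⁻ ω, (C * f ω) ^ s ∂P) ^ (1 / s) = C * (∫⁻ ω, f ω ^ s ∂P) ^ (1 / s) := by
  simp only [ENNReal.mul_rpow_of_nonneg _ _ hs.le]
  rw [lintegral_const_mul _ (hf.pow_const s), ENNReal.mul_rpow_of_nonneg _ _ (by positivity),
    ← ENNReal.rpow_mul, mul_one_div_cancel hs.ne', ENNReal.rpow_one]

section

variable {Ω : Type*} [MeasurableSpace Ω] {P : Measure Ω} [IsProbabilityMeasure P]

lemma integrable_sq_abs_sub {f g : Ω → ℝ} {u v : ℝ} (hf : AEStronglyMeasurable f P)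
    (hg : AEStronglyMeasurable g P) (hfm : ∀ ω, f ω ∈ Set.Icc u v)
    (hgm : ∀ ω, g ω ∈ Set.Icc u v) : Integrable (fun ω => |f ω - g ω| ^ 2) P :=
  Integrable.of_bound ((hf.sub hg).norm.pow 2) ((v - u) ^ 2)
    (Filter.Eventually.of_forall fun ω => by
      have h := sq_abs_sub_mem_Icc (hfm ω) (hgm ω)
      rw [Real.norm_eq_abs, abs_of_nonneg h.1]
      exact h.2)

lemma abs_integral_sq_sub_le {f f' Y : Ω → ℝ} {u v ε : ℝ} (hf : Measurable f)
    (hf' : Measurable f') (hY : Measurable Y) (hfm : ∀ ω, f ω ∈ Set.Icc u v)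
    (hfm' : ∀ ω, f' ω ∈ Set.Icc u v) (hYm : ∀ ω, Y ω ∈ Set.Icc u v)
    (h : ∀ ω, |f ω - f' ω| ≤ ε) :
    |∫ ω, |f ω - Y ω| ^ 2 ∂P - ∫ ω, |f' ω - Y ω| ^ 2 ∂P| ≤ 2 * (v - u) * ε := by
  rw [← integral_sub (integrable_sq_abs_sub hf.aestronglyMeasurable hY.aestronglyMeasurable hfm hYm)
    (integrable_sq_abs_sub hf'.aestronglyMeasurable hY.aestronglyMeasurable hfm' hYm)]
  have h1 := norm_integral_le_of_norm_le_const (μ := P)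
    (f := fun ω => |f ω - Y ω| ^ 2 - |f' ω - Y ω| ^ 2) (C := 2 * (v - u) * ε)
    (Filter.Eventually.of_forall fun ω => abs_sq_sub_sq_le (hfm ω) (hfm' ω) (hYm ω) (h ω))
  simpa using h1

lemma lp_add_const_le {f : Ω → ENNReal} (hf : Measurable f) {s : ℝ} (hs : 1 ≤ s) (C : ENNReal) :
    (∫⁻ ω, (f ω + C) ^ s ∂P) ^ (1 / s) ≤ (∫⁻ ω, f ω ^ s ∂P) ^ (1 / s) + C := by
  have h := ENNReal.lintegral_Lp_add_le (μ := P) hf.aemeasurable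
    (aemeasurable_const (b := C)) hs
  refine h.trans (le_of_eq ?_)
  congr 1
  simp only [lintegral_const, measure_univ, mul_one]
  rw [← ENNReal.rpow_mul, mul_one_div_cancel (by linarith), ENNReal.rpow_one]

end

/-- Only the `n` coordinates that the network reads are discretized, by midpoints of `N`
subintervals; the others are zero. The number of centers is thus independent of `D`. -/
lemma exists_param_cover {D n N : ℕ} (hnD : n ≤ D) (hN : 1 ≤ N) {β : ℝ} (hβ : 0 < β) :
    ∃ center : (Fin n → Fin N) → Fin D → ℝ, (∀ e, ‖center e‖ ≤ β) ∧
      ∀ θ : Fin D → ℝ, ‖θ‖ ≤ β → ∃ e, ∀ q < n, |coord θ q - coord (center e) q| ≤ β / N := by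
  let g (j : Fin N) : ℝ := -β + (β - -β) * (2 * (j : ℕ) + 1) / (2 * N)
  have hg (j : Fin N) : g j ∈ Set.Icc (-β) β := grid_mem (by linarith) j
  refine ⟨fun e i => if h : (i : ℕ) < n then g (e ⟨i, h⟩) else 0, fun e => ?_, fun θ hθ => ?_⟩
  · refine (pi_norm_le_iff_of_nonneg hβ.le).2 fun i => ?_
    dsimp only
    split_ifs
    · exact abs_le.2 (hg _)
    · simpa using hβ.le
  · have h (i : Fin n) := exists_grid_point (a := -β) (b := β) (by linarith) hN
      (abs_le.1 ((abs_coord_le_norm θ i).trans hθ))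
    choose e he using h
    refine ⟨e, fun q hq => ?_⟩
    have h2 : coord (fun i : Fin D => if h : (i : ℕ) < n then g (e ⟨i, h⟩) else 0) q
        = g (e ⟨q, hq⟩) := by
      simp [coord, hq, hq.trans_le hnD]
    rw [h2]
    refine (he ⟨q, hq⟩).trans (le_of_eq ?_)
    ring

lemma one_le_log_four_mul {M : ℕ} (hM : 1 ≤ M) {β c : ℝ} (hβ : 1 ≤ β) (hc : 1 ≤ c) :
    Real.log 4 ≤ Real.log (4 * M * β * c) ∧ 1 ≤ Real.log (4 * M * β * c) := by
  have hM' : (1 : ℝ) ≤ M := by exact_mod_cast hM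
  have h4 : (1 : ℝ) ≤ Real.log 4 := by
    rw [show (4 : ℝ) = 2 ^ 2 by norm_num, Real.log_pow]
    push_cast
    linarith [Real.log_two_gt_d9]
  have h : Real.log 4 ≤ Real.log (4 * M * β * c) := by
    refine Real.log_le_log (by norm_num) ?_
    have h1 : 1 ≤ (M : ℝ) * β * c :=
      one_le_mul_of_one_le_of_one_le (one_le_mul_of_one_le_of_one_le hM' hβ) hc
    linarith
  exact ⟨h, h4.trans h⟩

/-- The entropy of the cover: `log (2 * N)` is at most `2 * depth * W * Λ`, with `Λ` the logarithm
on the right, and `n ≤ depth * W ^ 2` multiplies it. -/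
lemma log_cover_le {M n depth N : ℕ} (hM : 1 ≤ M) (hdepth : 1 ≤ depth) (hn : 1 ≤ n)
    {W β c : ℝ} (hW : 2 ≤ W) (hβ : 1 ≤ β) (hc : 1 ≤ c) (hnW : (n : ℝ) ≤ depth * W ^ 2)
    (hN1 : 1 ≤ N) (hN : (N : ℝ) ≤ 4 * W ^ depth * c * β ^ depth * (M : ℝ) ^ (1 / 2 : ℝ) + 1) :
    Real.log (2 * (N : ℝ) ^ n) ≤ 2 * depth ^ 2 * W ^ 3 * Real.log (4 * M * β * c) := by
  obtain ⟨hΛ4, hΛ1⟩ := one_le_log_four_mul hM hβ hc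
  set Λ := Real.log (4 * M * β * c) with hΛ
  have hM' : (1 : ℝ) ≤ M := by exact_mod_cast hM
  have hN' : (1 : ℝ) ≤ N := by exact_mod_cast hN1
  have hn' : (1 : ℝ) ≤ n := by exact_mod_cast hn
  have hd' : (1 : ℝ) ≤ depth := by exact_mod_cast hdepth
  have hsqrt : (M : ℝ) ^ (1 / 2 : ℝ) ≤ (M : ℝ) ^ depth :=
    (Real.rpow_le_rpow_of_exponent_le hM' (by norm_num : (1 / 2 : ℝ) ≤ 1)).trans
      (by rw [Real.rpow_one]; exact le_self_pow₀ hM' (by omega))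
  have hsqrt1 : 1 ≤ (M : ℝ) ^ (1 / 2 : ℝ) := Real.one_le_rpow hM' (by norm_num)
  have hx1 : 1 ≤ W ^ depth * c * β ^ depth * (M : ℝ) ^ (1 / 2 : ℝ) :=
    one_le_mul_of_one_le_of_one_le (one_le_mul_of_one_le_of_one_le
      (one_le_mul_of_one_le_of_one_le (one_le_pow₀ (by linarith)) hc) (one_le_pow₀ hβ)) hsqrt1
  have hlogN : Real.log (2 * N) ≤ depth * Real.log W + depth * Λ + Real.log 4 := by
    have h1 : (2 : ℝ) * N ≤ W ^ depth * (4 * M * β * c) ^ depth * 4 := by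
      calc (2 : ℝ) * N ≤ W ^ depth * (4 * (M : ℝ) ^ (1 / 2 : ℝ) * β ^ depth * c) * 4 := by
            linarith
        _ ≤ W ^ depth * (4 ^ depth * (M : ℝ) ^ depth * β ^ depth * c ^ depth) * 4 := by
            gcongr
            · exact le_self_pow₀ (by norm_num) (by omega)
            · exact le_self_pow₀ hc (by omega)
        _ = _ := by rw [mul_pow, mul_pow, mul_pow]
    refine (Real.log_le_log (by positivity) h1).trans (le_of_eq ?_)
    rw [Real.log_mul (by positivity) (by norm_num), Real.log_mul (by positivity) (by positivity),
      Real.log_pow, Real.log_pow]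
  have hlogW : Real.log W ≤ W := by linarith [Real.log_le_sub_one_of_pos (by linarith : 0 < W)]
  have h2 : Real.log (2 * N) ≤ 2 * depth * W * Λ := by
    have h3 : W ≤ W * Λ := le_mul_of_one_le_right (by linarith) hΛ1
    have h4 : 2 * Λ ≤ W * Λ := mul_le_mul_of_nonneg_right hW (by linarith)
    have h5 : Λ ≤ depth * Λ := le_mul_of_one_le_left (by linarith) hd'
    calc Real.log (2 * N) ≤ depth * W + depth * Λ + depth * Λ := by
          have := mul_le_mul_of_nonneg_left hlogW (by linarith : (0 : ℝ) ≤ depth)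
          linarith
      _ = depth * (W + 2 * Λ) := by ring
      _ ≤ depth * (W * Λ + W * Λ) := by gcongr
      _ = _ := by ring
  have hlogN0 : 0 ≤ Real.log (2 * N) := Real.log_nonneg (by linarith)
  calc Real.log (2 * (N : ℝ) ^ n) ≤ Real.log ((2 * N) ^ n) := by
        refine Real.log_le_log (by positivity) ?_
        rw [mul_pow]
        gcongr
        exact le_self_pow₀ (by norm_num) (by omega)
    _ = n * Real.log (2 * N) := Real.log_pow _ _
    _ ≤ depth * W ^ 2 * (2 * depth * W * Λ) := mul_le_mul hnW h2 hlogN0 (by positivity)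
    _ = _ := by ring

lemma generalization_bound_le {depth : ℕ} (hdepth : 1 ≤ depth) {w W Λ s S x : ℝ} (hw : 0 ≤ w)
    (hW : 2 ≤ W) (hs : 1 ≤ s) (hx : 0 < x)
    (hS : S = max s (max 2 (2 * depth ^ 2 * W ^ 3 * Λ))) :
    2 * (w ^ 2 / (2 * x) ^ (1 / 2 : ℝ) * Real.exp 1 * (S / 2) ^ (1 / 2 : ℝ)
        + w * depth / x ^ (1 / 2 : ℝ))
      ≤ max w 1 ^ 2 * (10 * depth * W ^ (3 / 2 : ℝ) * max s Λ) / x ^ (1 / 2 : ℝ) := by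
  have hd' : (1 : ℝ) ≤ depth := by exact_mod_cast hdepth
  set μ := max s Λ with hμ
  have hμs : s ≤ μ := le_max_left _ _
  have hμΛ : Λ ≤ μ := le_max_right _ _
  have hμ1 : 1 ≤ μ := hs.trans hμs
  set V := W ^ (3 / 2 : ℝ) with hV
  have hV2 : V ^ 2 = W ^ 3 := by
    rw [hV, ← Real.rpow_natCast, ← Real.rpow_natCast, ← Real.rpow_mul (by linarith)]
    norm_num
  have hV2' : 2 ≤ V := by
    calc 2 ≤ W := hW
      _ = W ^ (1 : ℝ) := (Real.rpow_one W).symm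
      _ ≤ V := Real.rpow_le_rpow_of_exponent_le (by linarith) (by norm_num)
  have hY : 2 ≤ depth * V * μ := by
    calc (2 : ℝ) = 1 * 2 * 1 := by norm_num
      _ ≤ depth * V * μ := by gcongr
  have hμμ : μ ≤ depth * V * μ := le_mul_of_one_le_left (by linarith)
    (one_le_mul_of_one_le_of_one_le hd' (by linarith))
  have hS2 : S ≤ 2 * (depth * V * μ) ^ 2 := by
    rw [hS]
    refine max_le ?_ (max_le ?_ ?_)
    · nlinarith
    · nlinarith
    · calc 2 * depth ^ 2 * W ^ 3 * Λ = 2 * (depth * V) ^ 2 * Λ := by rw [mul_pow, hV2]; ring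
        _ ≤ 2 * (depth * V) ^ 2 * μ ^ 2 := by
          gcongr
          nlinarith
        _ = _ := by ring
  have hS0 : 0 ≤ S := by rw [hS]; exact le_max_of_le_left (by linarith)
  have h1 : (S / 2) ^ (1 / 2 : ℝ) ≤ depth * V * μ := by
    rw [← Real.sqrt_eq_rpow]
    exact Real.sqrt_le_iff.2 ⟨by positivity, by linarith⟩
  have h2 : (2 * x) ^ (1 / 2 : ℝ) = 2 ^ (1 / 2 : ℝ) * x ^ (1 / 2 : ℝ) :=
    Real.mul_rpow (by norm_num) hx.le
  have h3 : (1 : ℝ) ≤ 2 ^ (1 / 2 : ℝ) := Real.one_le_rpow (by norm_num) (by norm_num)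
  have hw1 : w ≤ max w 1 ^ 2 := by
    have h4 : (1 : ℝ) ≤ max w 1 := le_max_right _ _
    have h5 : w ≤ max w 1 := le_max_left _ _
    nlinarith
  have hw2 : w ^ 2 ≤ max w 1 ^ 2 := pow_le_pow_left₀ hw (le_max_left _ _) 2
  have hxp : 0 < x ^ (1 / 2 : ℝ) := by positivity
  -- With `3` in place of `e` the two summands give the factor `2 * (3 + 1) = 8`, below the required
  -- `10`.
  have he : Real.exp 1 ≤ 3 := by linarith [Real.exp_one_lt_d9]
  have h6 : w ^ 2 / (2 * x) ^ (1 / 2 : ℝ) ≤ max w 1 ^ 2 / x ^ (1 / 2 : ℝ) := by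
    rw [h2]
    exact div_le_div₀ (by positivity) hw2 hxp (le_mul_of_one_le_left hxp.le h3)
  have h7 : (depth : ℝ) ≤ depth * V * μ := by
    rw [mul_assoc]
    exact le_mul_of_one_le_right (by linarith)
      (one_le_mul_of_one_le_of_one_le (by linarith) hμ1)
  calc 2 * (w ^ 2 / (2 * x) ^ (1 / 2 : ℝ) * Real.exp 1 * (S / 2) ^ (1 / 2 : ℝ)
        + w * depth / x ^ (1 / 2 : ℝ))
      ≤ 2 * (max w 1 ^ 2 / x ^ (1 / 2 : ℝ) * 3 * (depth * V * μ)
        + max w 1 ^ 2 * (depth * V * μ) / x ^ (1 / 2 : ℝ)) := by gcongr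
    _ = max w 1 ^ 2 * (8 * (depth * V * μ)) / x ^ (1 / 2 : ℝ) := by ring
    _ ≤ max w 1 ^ 2 * (10 * (depth * V * μ)) / x ^ (1 / 2 : ℝ) := by gcongr; norm_num
    _ = _ := by ring

lemma log_four_mul_le {M : ℕ} (hM : 1 ≤ M) {p β c : ℝ} (hc : 1 ≤ c) (hβ : c ≤ β) :
    10 * max (p / 2) (Real.log (4 * M * β * c))
      ≤ 16 * β * max p (Real.log (Real.exp 1 * M)) ^ 2 := by
  have hM' : (1 : ℝ) ≤ M := by exact_mod_cast hM
  have hβ1 : 1 ≤ β := hc.trans hβ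
  have e1 : Real.log (Real.exp 1 * M) = 1 + Real.log M := by
    rw [Real.log_mul (Real.exp_pos 1).ne' (by positivity), Real.log_exp]
  have hlM : 0 ≤ Real.log M := Real.log_nonneg hM'
  rw [e1]
  set m := 1 + Real.log M with hm
  have hm1 : 1 ≤ m := by linarith
  set μ := max p m with hμ
  have hμm : m ≤ μ := le_max_right _ _
  have hμp : p ≤ μ := le_max_left _ _
  have hμ1 : 1 ≤ μ := hm1.trans hμm
  have hμ2 : μ ≤ μ ^ 2 := le_self_pow₀ hμ1 two_ne_zero
  have hβμ : β * μ ≤ β * μ ^ 2 := mul_le_mul_of_nonneg_left hμ2 (by linarith)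
  have hμβ : μ ≤ β * μ := le_mul_of_one_le_left (by linarith) hβ1
  rcases max_cases (p / 2) (Real.log (4 * M * β * c)) with ⟨h, -⟩ | ⟨h, -⟩
  · rw [h]
    linarith
  · rw [h]
    have h1 : Real.log (4 * M * β * c) ≤ 2 * Real.log 2 + Real.log M + 2 * Real.log β := by
      calc Real.log (4 * M * β * c) ≤ Real.log (2 ^ 2 * M * β ^ 2) := by
            refine Real.log_le_log (by positivity) ?_
            calc (4 : ℝ) * M * β * c ≤ 4 * M * β * β := by gcongr
              _ = _ := by ring
        _ = _ := by
            rw [Real.log_mul (by positivity) (by positivity),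
              Real.log_mul (by positivity) (by positivity), Real.log_pow, Real.log_pow]
            push_cast
            ring
    -- Tangent to the logarithm at `1.25`. The slope is chosen so that `10 * 2 * 0.8 = 16`, the
    -- target coefficient of `β`.
    have h2 : Real.log β ≤ 0.8 * β - 0.75 := by
      have h3 := Real.log_le_sub_one_of_pos (by linarith : 0 < 0.8 * β)
      have h4 := Real.log_le_sub_one_of_pos (by norm_num : (0 : ℝ) < 1.25)
      have h5 : Real.log β = Real.log (0.8 * β) + Real.log 1.25 := by
        rw [← Real.log_mul (by positivity) (by norm_num)]
        congr 1
        ring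
      linarith
    have h6 : β * m ≤ β * μ := mul_le_mul_of_nonneg_left hμm (by linarith)
    nlinarith [Real.log_two_lt_d9, mul_nonneg (sub_nonneg.2 hβ1) (sub_nonneg.2 hm1)]

end

/-! ### Uniform generalization bound -/

section

/-- The deviation of the empirical risk from the risk, uniformly over all networks with parameters
bounded by `β`. -/
theorem exists_generalization_bound {d D depth M : ℕ} {l : ℕ → ℕ} (h0 : l 0 = d)
    (h1 : l depth = 1) (hdepth : 1 ≤ depth) (hl : ∀ i ≤ depth, 1 ≤ l i) (hM : 1 ≤ M)
    (hD : numParams l depth ≤ D) {a b u v c β s : ℝ} (huv : u < v)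
    (hc : 1 ≤ c) (hca : |a| ≤ c) (hcb : |b| ≤ c) (hβ : c ≤ β) (hs : 1 ≤ s)
    {Ω : Type*} [MeasurableSpace Ω] {P : Measure Ω} [IsProbabilityMeasure P]
    {X : ℕ → Ω → (Fin d → ℝ)} {Y : ℕ → Ω → ℝ}
    (hXm : ∀ j ∈ Set.Icc 1 M, Measurable (X j)) (hYm : ∀ j ∈ Set.Icc 1 M, Measurable (Y j))
    (hX : ∀ j ∈ Set.Icc 1 M, ∀ ω, X j ω ∈ cube d a b)
    (hY : ∀ j ∈ Set.Icc 1 M, ∀ ω, Y j ω ∈ Set.Icc u v)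
    (hind : iIndepFun (fun (j : Set.Icc 1 M) (ω : Ω) => (X j ω, Y j ω)) P)
    (hident : ∀ j ∈ Set.Icc 1 M,
      IdentDistrib (fun ω => (X j ω, Y j ω)) (fun ω => (X 1 ω, Y 1 ω)) P P) :
    ∃ G : Ω → ℝ, Measurable G ∧ (∀ ω, 0 ≤ G ω) ∧
      (∀ ω, ∀ θ : Fin D → ℝ, ‖θ‖ ≤ β →
        |empiricalRisk M (scalarNet h0 h1 u v θ) (fun j => X j ω) (fun j => Y j ω)
          - ∫ ω', |scalarNet h0 h1 u v θ (X 1 ω') - Y 1 ω'| ^ 2 ∂P| ≤ G ω) ∧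
      (∫⁻ ω, ENNReal.ofReal (2 * G ω) ^ s ∂P) ^ (1 / s)
        ≤ ENNReal.ofReal (max (v - u) 1 ^ 2 * (10 * depth * ((maxWidth l depth : ℝ) + 1) ^ (3 / 2 : ℝ)
          * max s (Real.log (4 * M * β * c))) / (M : ℝ) ^ (1 / 2 : ℝ)) := by
  have hβ1 : 1 ≤ β := hc.trans hβ
  have hM' : (1 : ℝ) ≤ M := by exact_mod_cast hM
  have h1M : 1 ∈ Set.Icc 1 M := ⟨le_rfl, hM⟩
  set W : ℝ := (maxWidth l depth : ℝ) + 1 with hW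
  have hW2 : 2 ≤ W := by
    have : 1 ≤ maxWidth l depth := (hl depth le_rfl).trans (le_maxWidth l le_rfl)
    have : (1 : ℝ) ≤ maxWidth l depth := by exact_mod_cast this
    linarith
  set n := numParams l depth with hn
  have hn1 : 1 ≤ n := numParams_pos hdepth (hl 1 hdepth)
  have hnW : (n : ℝ) ≤ depth * W ^ 2 := by
    rw [hW]; exact_mod_cast numParams_le l depth
  -- The mesh `β / N` with `N ≥ x` is so fine that replacing `θ` by a center in both the empirical
  -- and the true risk costs at most `(v - u) * depth / √M` altogether.
  set x : ℝ := 4 * W ^ depth * c * β ^ depth * (M : ℝ) ^ (1 / 2 : ℝ) with hx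
  have hx0 : 0 < x := by positivity
  set N : ℕ := ⌈x⌉₊ with hN
  have hxN : x ≤ N := Nat.le_ceil x
  have hN1 : 1 ≤ N := Nat.one_le_ceil_iff.2 hx0
  obtain ⟨center, hcen, hcov⟩ := exists_param_cover (β := β) hD hN1 (by linarith)
  have hne : Nonempty (Fin N) := ⟨⟨0, hN1⟩⟩
  let net (θ : Fin D → ℝ) : (Fin d → ℝ) → ℝ := scalarNet h0 h1 u v θ
  have hnetm (θ : Fin D → ℝ) : Measurable (net θ) :=
    ((continuous_scalarNet h0 h1 u v).comp (continuous_const.prodMk continuous_id)).measurable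
  have hnet (θ : Fin D → ℝ) (z : Fin d → ℝ) : net θ z ∈ Set.Icc u v :=
    scalarNet_mem h0 h1 hdepth huv.le θ z
  let emp (θ : Fin D → ℝ) (ω : Ω) : ℝ :=
    empiricalRisk M (net θ) (fun j => X j ω) (fun j => Y j ω)
  let risk (θ : Fin D → ℝ) : ℝ := ∫ ω', |net θ (X 1 ω') - Y 1 ω'| ^ 2 ∂P
  let U (e : Fin n → Fin N) (ω : Ω) : ℝ := emp (center e) ω - risk (center e)
  have hUm (e : Fin n → Fin N) : Measurable (U e) := by
    refine Measurable.sub_const (Measurable.const_mul (Finset.measurable_fun_sum _ fun j hj => ?_) _) _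
    have hj := Finset.mem_Icc.1 hj
    have hm := ((hnetm (center e)).comp (hXm j hj)).sub (hYm j hj)
    exact hm.abs.pow_const 2
  have hloss (θ : Fin D → ℝ) : Measurable fun z : (Fin d → ℝ) × ℝ => |net θ z.1 - z.2| ^ 2 :=
    (((hnetm θ).comp measurable_fst).sub measurable_snd).abs.pow_const 2
  have htail : ∀ e, ∀ t > 0, P {ω | t < |U e ω|} ≤ ENNReal.ofReal
      (2 * Real.exp (-(t / ((v - u) ^ 2 / (2 * M) ^ (1 / 2 : ℝ))) ^ (2 : ℝ))) := by
    intro e t ht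
    refine measure_abs_mean_sub_gt_le (ξ := fun j ω => |net (center e) (X j ω) - Y j ω| ^ 2) hM
      (fun j hj => (hloss (center e)).comp ((hXm j hj).prodMk (hYm j hj)))
      (pow_pos (sub_pos.2 huv) 2)
      (fun j hj ω => sq_abs_sub_mem_Icc (hnet _ _) (hY j hj ω)) ?_ (fun j hj => ?_) ht
    · exact hind.comp (fun _ z => |net (center e) z.1 - z.2| ^ 2) fun _ => hloss _
    · exact ((hident j hj).comp (hloss (center e))).integral_eq
  -- The exponent for the maximal inequality; the last entry dominates the logarithm of twice the
  -- number of centers.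
  set S : ℝ := max s (max 2 (2 * depth ^ 2 * W ^ 3 * Real.log (4 * M * β * c))) with hS
  have hsup := lp_sup_le_of_tail (P := P) hUm (q := s) (s := S)
    (div_pos (pow_pos (sub_pos.2 huv) 2) (by positivity)) htail (by linarith) (le_max_left _ _)
    ((le_max_left _ _).trans (le_max_right _ _)) (by
      refine le_trans ?_ ((le_max_right _ _).trans (le_max_right _ _))
      have h := log_cover_le hM hdepth hn1 hW2 hβ1 hc hnW hN1
        (Nat.ceil_lt_add_one hx0.le).le
      simpa using h)
  have hmeas : Measurable fun ω => Finset.univ.sup' Finset.univ_nonempty fun e => |U e ω| := by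
    convert Finset.measurable_sup' (s := Finset.univ) (Finset.univ_nonempty (α := Fin n → Fin N))
      (f := fun e ω => |U e ω|) fun e _ => (hUm e).abs using 1
    ext ω
    simp
  have hsup0 (ω : Ω) : 0 ≤ Finset.univ.sup' Finset.univ_nonempty fun e => |U e ω| :=
    (abs_nonneg _).trans (Finset.le_sup' (fun e => |U e ω|)
      (Finset.mem_univ (Classical.arbitrary (Fin n → Fin N))))
  have hoff0 : 0 ≤ (v - u) * depth / (M : ℝ) ^ (1 / 2 : ℝ) :=
    div_nonneg (mul_nonneg (by linarith) (by positivity)) (by positivity)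
  refine ⟨fun ω => (Finset.univ.sup' Finset.univ_nonempty fun e => |U e ω|)
    + (v - u) * depth / (M : ℝ) ^ (1 / 2 : ℝ), hmeas.add_const _,
    fun ω => add_nonneg (hsup0 ω) hoff0, fun ω θ hθ => ?_, ?_⟩
  · obtain ⟨e, he⟩ := hcov θ hθ
    have hbd (z : Fin d → ℝ) (hz : z ∈ cube d a b) : |net θ z - net (center e) z|
        ≤ depth * W ^ depth * β ^ (depth - 1) * c * (β / N) :=
      abs_scalarNet_sub_scalarNet_le h0 h1 hβ1 hc hθ (hcen e) (by positivity) he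
        (abs_le_of_mem_cube hca hcb hz)
    have hE := abs_empiricalRisk_sub_le hM (x := fun j => X j ω) (y := fun j => Y j ω) (hnet θ)
      (hnet (center e)) (fun j hj => hY j hj ω) (fun j hj => hbd _ (hX j hj ω))
    have hR := abs_integral_sq_sub_le (P := P) ((hnetm θ).comp (hXm 1 h1M))
      ((hnetm (center e)).comp (hXm 1 h1M)) (hYm 1 h1M) (fun _ => hnet θ _)
      (fun _ => hnet (center e) _) (hY 1 h1M) (fun ω' => hbd _ (hX 1 h1M ω'))
    have hU := Finset.le_sup' (fun e => |U e ω|) (Finset.mem_univ e)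
    have hoff : 2 * (2 * (v - u) * (depth * W ^ depth * β ^ (depth - 1) * c * (β / N)))
        ≤ (v - u) * depth / (M : ℝ) ^ (1 / 2 : ℝ) := by
      have hpow : β ^ (depth - 1) * β = β ^ depth := by
        rw [← pow_succ, Nat.sub_add_cancel hdepth]
      have e1 : 2 * (2 * (v - u) * (depth * W ^ depth * β ^ (depth - 1) * c * (β / N)))
          = (v - u) * depth * (4 * W ^ depth * c * β ^ depth) / N := by
        rw [← hpow]; ring
      have hN0 : (0 : ℝ) < N := hx0.trans_le hxN
      rw [e1, div_le_div_iff₀ hN0 (by positivity), mul_assoc, ← hx]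
      exact mul_le_mul_of_nonneg_left hxN (mul_nonneg (by linarith) (by positivity))
    have e2 : emp θ ω - risk θ = (emp θ ω - emp (center e) ω) + U e ω
        - (risk θ - risk (center e)) := by
      simp only [U]; ring
    change |emp θ ω - risk θ| ≤ _
    rw [e2]
    refine (abs_sub _ _).trans ((add_le_add (abs_add_le _ _) le_rfl).trans ?_)
    have hE' : |emp θ ω - emp (center e) ω| ≤ _ := hE
    have hR' : |risk θ - risk (center e)| ≤ _ := hR
    linarith
  · have hsplit (ω : Ω) : ENNReal.ofReal (2 * ((Finset.univ.sup' Finset.univ_nonempty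
        fun e => |U e ω|) + (v - u) * depth / (M : ℝ) ^ (1 / 2 : ℝ)))
        = ENNReal.ofReal 2 * (ENNReal.ofReal (Finset.univ.sup' Finset.univ_nonempty
          fun e => |U e ω|) + ENNReal.ofReal ((v - u) * depth / (M : ℝ) ^ (1 / 2 : ℝ))) := by
      rw [← ENNReal.ofReal_add (hsup0 ω) hoff0, ← ENNReal.ofReal_mul (by norm_num)]
    simp only [hsplit]
    rw [lp_const_mul (hmeas.ennreal_ofReal.add_const _) (by linarith)]
    refine (mul_le_mul_right ((lp_add_const_le hmeas.ennreal_ofReal hs _).trans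
      (add_le_add_left hsup _)) _).trans ?_
    rw [← ENNReal.ofReal_add (by positivity) hoff0, ← ENNReal.ofReal_mul (by norm_num)]
    exact ENNReal.ofReal_le_ofReal (generalization_bound_le hdepth (by linarith) hW2 hs
      (by linarith) hS)

end

/-! ### Measurability and combination of the three errors -/

section

lemma continuousOn_of_l1_lipschitz {d : ℕ} {E : (Fin d → ℝ) → ℝ} {s : Set (Fin d → ℝ)} {Lip : ℝ}
    (hLip : 0 ≤ Lip) (h : ∀ x ∈ s, ∀ y ∈ s, |E x - E y| ≤ Lip * ∑ i, |x i - y i|) :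
    ContinuousOn E s := by
  refine (LipschitzOnWith.of_dist_le_mul (K := (Lip * d).toNNReal) fun x hx y hy => ?_).continuousOn
  rw [Real.coe_toNNReal _ (by positivity), Real.dist_eq, mul_assoc]
  refine (h x hx y hy).trans (mul_le_mul_of_nonneg_left ?_ hLip)
  refine (Finset.sum_le_sum fun i _ => (dist_le_pi_dist x y i)).trans (le_of_eq ?_)
  simp

lemma measurable_comp_countable {Ω α ι : Type*} [MeasurableSpace Ω] [MeasurableSpace α]
    [MeasurableSpace ι] [Countable ι] [MeasurableSingletonClass ι] {T : ι → Ω → α}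
    (hT : ∀ i, Measurable (T i)) {k : Ω → ι} (hk : Measurable k) :
    Measurable fun ω => T (k ω) ω :=
  (measurable_from_prod_countable_right (f := fun z : ι × Ω => T z.1 z.2) hT).comp
    (hk.prodMk measurable_id)

lemma measurable_lintegral_net {d D depth : ℕ} {l : ℕ → ℕ} (h0 : l 0 = d) (h1 : l depth = 1)
    (u v : ℝ) {Ω : Type*} [MeasurableSpace Ω] {T : Ω → Fin D → ℝ} (hT : Measurable T)
    {E : (Fin d → ℝ) → ℝ} (hE : Measurable E) (ν : Measure (Fin d → ℝ)) [SFinite ν] :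
    Measurable fun ω => ∫⁻ x, ‖scalarNet h0 h1 u v (T ω) x - E x‖ₑ ^ 2 ∂ν := by
  refine Measurable.lintegral_prod_right'
    (f := fun z : Ω × (Fin d → ℝ) => ‖scalarNet h0 h1 u v (T z.1) z.2 - E z.2‖ₑ ^ 2) ?_
  have h := (continuous_scalarNet (D := D) h0 h1 u v).measurable.comp
    ((hT.comp measurable_fst).prodMk (measurable_snd (α := Ω) (β := Fin d → ℝ)))
  exact (h.sub (hE.comp measurable_snd)).enorm.pow_const 2

lemma lintegral_enorm_sq_eq {Ω : Type*} [MeasurableSpace Ω] {P : Measure Ω}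
    [IsProbabilityMeasure P] {d : ℕ} {a b u v : ℝ} {X : Ω → Fin d → ℝ} (hXm : Measurable X)
    (hX : ∀ ω, X ω ∈ cube d a b) {F E : (Fin d → ℝ) → ℝ} (hF : Measurable F) (hE : Measurable E)
    (hFm : ∀ x, F x ∈ Set.Icc u v) (hEm : ∀ x ∈ cube d a b, E x ∈ Set.Icc u v) :
    ∫⁻ x in cube d a b, ‖F x - E x‖ₑ ^ 2 ∂(P.map X)
      = ENNReal.ofReal (∫ ω, |F (X ω) - E (X ω)| ^ 2 ∂P) := by
  have hms : MeasurableSet (cube d a b) := measurableSet_Icc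
  have hpre : X ⁻¹' cube d a b = Set.univ := Set.eq_univ_of_forall hX
  rw [Measure.restrict_map hXm hms, hpre, Measure.restrict_univ,
    lintegral_map (f := fun x => ‖F x - E x‖ₑ ^ 2) ((hF.sub hE).enorm.pow_const 2) hXm,
    ofReal_integral_eq_lintegral_ofReal (integrable_sq_abs_sub
      (f := fun ω => F (X ω)) (g := fun ω => E (X ω))
      (hF.comp hXm).aestronglyMeasurable (hE.comp hXm).aestronglyMeasurable
      (fun ω => hFm _) (fun ω => hEm _ (hX ω)))
      (Filter.Eventually.of_forall fun ω => by dsimp only; positivity)]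
  refine lintegral_congr fun ω => ?_
  rw [Real.enorm_eq_ofReal_abs, ENNReal.ofReal_pow (abs_nonneg _)]

lemma rpow_half_le_of_sq {x y : ℝ} (hy : 0 ≤ y) (h : x ≤ y ^ 2) : x ^ (1 / 2 : ℝ) ≤ y := by
  rw [← Real.sqrt_eq_rpow]
  exact Real.sqrt_le_iff.2 ⟨hy, h⟩

lemma rpow_half_sq {x : ℝ} (hx : 0 ≤ x) : (x ^ (1 / 2 : ℝ)) ^ 2 = x := by
  rw [← Real.sqrt_eq_rpow, Real.sq_sqrt hx]

/-- The second bound of the main theorem dominates the first one. -/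
lemma first_bound_le_second_bound {d depth M K : ℕ} (hM : 1 ≤ M) {p Lip a b u v c β A W : ℝ}
    (huv : u < v) (hab : a < b) (hc : 1 ≤ c) (hcu : 2 * |u| ≤ c) (hcv : 2 * |v| ≤ c)
    (hca : |a| ≤ c) (hcb : |b| ≤ c) (hcL : Lip ≤ c) (hβ : c ≤ β) (hp : 0 < p)
    (hA : 0 ≤ A) (hW : 0 ≤ W) :
    3 * d * Lip * (b - a) / A ^ (1 / (d : ℝ))
      + 2 * ((v - u) * depth * W ^ depth * c ^ (depth + 1) * max (p / 2) 1) ^ (1 / 2 : ℝ)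
          / (K : ℝ) ^ ((2 * (depth : ℝ))⁻¹ * (W ^ 2)⁻¹)
      + max (v - u) 1
          * (10 * depth * W ^ (3 / 2 : ℝ) * max (p / 2) (Real.log (4 * M * β * c))) ^ (1 / 2 : ℝ)
          / (M : ℝ) ^ (1 / 4 : ℝ)
    ≤ 6 * d * c ^ 2 / A ^ (1 / (d : ℝ))
      + 2 * (depth * W ^ depth * c ^ (depth + 2) * max p 1) ^ (1 / 2 : ℝ)
          / (K : ℝ) ^ ((2 * (depth : ℝ))⁻¹ * (W ^ 2)⁻¹)
      + 4 * c * β ^ (1 / 2 : ℝ) * (depth : ℝ) ^ (1 / 2 : ℝ) * W ^ (3 / 4 : ℝ)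
          * max p (Real.log (Real.exp 1 * M)) / (M : ℝ) ^ (1 / 4 : ℝ) := by
  have hba : b - a ≤ 2 * c := by linarith [(abs_le.1 hca).1, (abs_le.1 hcb).2]
  have hvu : v - u ≤ c := by linarith [neg_abs_le u, le_abs_self v]
  have hμ : 0 < max p (Real.log (Real.exp 1 * M)) := lt_max_of_lt_left hp
  refine add_le_add (add_le_add ?_ ?_) ?_
  · refine div_le_div_of_nonneg_right ?_ (by positivity)
    calc 3 * d * Lip * (b - a) ≤ 3 * d * c * (2 * c) := by gcongr
      _ = _ := by ring
  · refine div_le_div_of_nonneg_right ?_ (by positivity)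
    refine mul_le_mul_of_nonneg_left (Real.rpow_le_rpow ?_ ?_ (by norm_num)) (by norm_num)
    · have : 0 ≤ v - u := by linarith
      positivity
    · calc (v - u) * depth * W ^ depth * c ^ (depth + 1) * max (p / 2) 1
          ≤ c * depth * W ^ depth * c ^ (depth + 1) * max p 1 := by gcongr; linarith
        _ = _ := by ring
  · refine div_le_div_of_nonneg_right ?_ (by positivity)
    have h1 : (10 * depth * W ^ (3 / 2 : ℝ) * max (p / 2) (Real.log (4 * M * β * c))) ^ (1 / 2 : ℝ)
        ≤ 4 * β ^ (1 / 2 : ℝ) * (depth : ℝ) ^ (1 / 2 : ℝ) * W ^ (3 / 4 : ℝ)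
          * max p (Real.log (Real.exp 1 * M)) := by
      have hβ0 : 0 ≤ β := by linarith
      refine rpow_half_le_of_sq (by positivity) ?_
      have h2 : (W ^ (3 / 4 : ℝ)) ^ 2 = W ^ (3 / 2 : ℝ) := by
        rw [← Real.rpow_natCast, ← Real.rpow_mul hW]; norm_num
      rw [mul_pow, mul_pow, mul_pow, mul_pow, rpow_half_sq hβ0, rpow_half_sq (Nat.cast_nonneg _),
        h2]
      have h3 := mul_le_mul_of_nonneg_left (log_four_mul_le hM (p := p) hc hβ)
        (by positivity : 0 ≤ depth * W ^ (3 / 2 : ℝ))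
      linarith
    calc max (v - u) 1 * (10 * depth * W ^ (3 / 2 : ℝ)
          * max (p / 2) (Real.log (4 * M * β * c))) ^ (1 / 2 : ℝ)
        ≤ c * (4 * β ^ (1 / 2 : ℝ) * (depth : ℝ) ^ (1 / 2 : ℝ) * W ^ (3 / 4 : ℝ)
          * max p (Real.log (Real.exp 1 * M))) :=
          mul_le_mul (max_le hvu hc) h1 (Real.rpow_nonneg (mul_nonneg (by positivity)
            (le_max_of_le_left (by linarith))) _) (by linarith)
      _ = _ := by ring

/-- The error of the selected network is bounded by the approximation, the generalization and the
optimization error. -/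
lemma lp_error_le {Ω : Type*} [MeasurableSpace Ω] {P : Measure Ω} [IsProbabilityMeasure P]
    {err : Ω → ENNReal} (herr : Measurable err) {G Z : Ω → ℝ} (hG : Measurable G)
    (hZ : Measurable Z) {ε lam p t₂ t₃ : ℝ} (hp : 0 < p) (hε : 0 ≤ ε) (ht₂ : 0 ≤ t₂) (ht₃ : 0 ≤ t₃)
    (hlam : 0 ≤ lam)
    (hle : ∀ᵐ ω ∂P, err ω ≤ ENNReal.ofReal (ε ^ 2 + 2 * G ω + lam * Z ω))
    {s : ℝ} (hs : s = max (p / 2) 1)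
    (hZb : ENNReal.ofReal lam * (∫⁻ ω, ENNReal.ofReal (Z ω) ^ s ∂P) ^ (1 / s)
      ≤ ENNReal.ofReal (t₂ ^ 2))
    (hGb : (∫⁻ ω, ENNReal.ofReal (2 * G ω) ^ s ∂P) ^ (1 / s) ≤ ENNReal.ofReal (t₃ ^ 2)) :
    (∫⁻ ω, err ω ^ (p / 2) ∂P) ^ (1 / p) ≤ ENNReal.ofReal (ε + t₂ + t₃) := by
  have hs1 : 1 ≤ s := hs ▸ le_max_right _ _
  have hq : p / 2 ≤ s := hs ▸ le_max_left _ _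
  have hGm : Measurable fun ω => ENNReal.ofReal (2 * G ω) := (hG.const_mul 2).ennreal_ofReal
  have hZm : Measurable fun ω => ENNReal.ofReal lam * ENNReal.ofReal (Z ω) :=
    hZ.ennreal_ofReal.const_mul _
  have h1 : (∫⁻ ω, err ω ^ s ∂P) ^ (1 / s)
      ≤ ENNReal.ofReal (t₃ ^ 2) + ENNReal.ofReal (t₂ ^ 2) + ENNReal.ofReal (ε ^ 2) := by
    calc (∫⁻ ω, err ω ^ s ∂P) ^ (1 / s)
        ≤ (∫⁻ ω, ((ENNReal.ofReal (2 * G ω) + ENNReal.ofReal lam * ENNReal.ofReal (Z ω))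
          + ENNReal.ofReal (ε ^ 2)) ^ s ∂P) ^ (1 / s) := by
          refine ENNReal.rpow_le_rpow (lintegral_mono_ae ?_) (by positivity)
          filter_upwards [hle] with ω hω
          refine ENNReal.rpow_le_rpow (hω.trans ?_) (by linarith)
          rw [← ENNReal.ofReal_mul hlam]
          refine (ENNReal.ofReal_add_le.trans (add_le_add_left ENNReal.ofReal_add_le _)).trans
            (le_of_eq ?_)
          ring
      _ ≤ (∫⁻ ω, (ENNReal.ofReal (2 * G ω) + ENNReal.ofReal lam * ENNReal.ofReal (Z ω)) ^ s ∂P)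
            ^ (1 / s) + ENNReal.ofReal (ε ^ 2) := lp_add_const_le (hGm.add hZm) hs1 _
      _ ≤ ((∫⁻ ω, ENNReal.ofReal (2 * G ω) ^ s ∂P) ^ (1 / s)
            + (∫⁻ ω, (ENNReal.ofReal lam * ENNReal.ofReal (Z ω)) ^ s ∂P) ^ (1 / s))
            + ENNReal.ofReal (ε ^ 2) := by
          gcongr
          exact ENNReal.lintegral_Lp_add_le hGm.aemeasurable hZm.aemeasurable hs1
      _ ≤ _ := by
          rw [lp_const_mul hZ.ennreal_ofReal (by linarith)]
          gcongr
  -- Minkowski's inequality needs an exponent at least `1`; the bound for `s` is now brought down to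
  -- `p / 2`.
  have h2 := (lp_mono herr (half_pos hp) hq).trans h1
  rw [← ENNReal.ofReal_add (by positivity) (by positivity),
    ← ENNReal.ofReal_add (by positivity) (by positivity)] at h2
  have e : 1 / p = 1 / (p / 2) * (1 / 2) := by field_simp
  rw [e, ENNReal.rpow_mul]
  refine (ENNReal.rpow_le_rpow h2 (by norm_num)).trans ?_
  rw [ENNReal.ofReal_rpow_of_nonneg (by positivity) (by norm_num)]
  refine ENNReal.ofReal_le_ofReal (rpow_half_le_of_sq (by positivity) ?_)
  nlinarith [mul_nonneg hε ht₂, mul_nonneg hε ht₃, mul_nonneg ht₂ ht₃]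

/-- The left side is the Lipschitz constant of the empirical risk times the bound for the best
initialization. It is compared with a square because a root is taken at the end, which also halves
the exponent of `K`; `n ≤ depth * W ^ 2` and `K ≥ 1` replace `n` by `depth * W ^ 2`. -/
lemma optimization_bound_le {depth n K : ℕ} (hdepth : 1 ≤ depth) (hn : 1 ≤ n) (hK : 1 ≤ K)
    {w W c s : ℝ} (hw : 0 ≤ w) (hW : 1 ≤ W) (hc : 0 ≤ c) (hs : 0 ≤ s)
    (hnW : (n : ℝ) ≤ depth * W ^ 2) :
    2 * w * (depth * W ^ depth * c ^ (depth - 1) * c) * (2 * c * (K : ℝ) ^ (-1 / (n : ℝ)) * s)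
      ≤ (2 * (w * depth * W ^ depth * c ^ (depth + 1) * s) ^ (1 / 2 : ℝ)
          / (K : ℝ) ^ ((2 * (depth : ℝ))⁻¹ * (W ^ 2)⁻¹)) ^ 2 := by
  have hK' : (1 : ℝ) ≤ K := by exact_mod_cast hK
  have hd' : (1 : ℝ) ≤ depth := by exact_mod_cast hdepth
  have hn' : (1 : ℝ) ≤ n := by exact_mod_cast hn
  have h1 : ((K : ℝ) ^ ((2 * (depth : ℝ))⁻¹ * (W ^ 2)⁻¹)) ^ 2
      = (K : ℝ) ^ (1 / (depth * W ^ 2) : ℝ) := by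
    rw [← Real.rpow_natCast, ← Real.rpow_mul (by positivity)]
    congr 1
    push_cast
    field_simp
  have h2 : (K : ℝ) ^ (-1 / (n : ℝ)) ≤ ((K : ℝ) ^ (1 / (depth * W ^ 2) : ℝ))⁻¹ := by
    rw [← Real.rpow_neg (by positivity)]
    refine Real.rpow_le_rpow_of_exponent_le hK' ?_
    rw [neg_div]
    exact neg_le_neg (one_div_le_one_div_of_le (by linarith) hnW)
  have hpow : c ^ (depth - 1) * c * c = c ^ (depth + 1) := by
    rw [← pow_succ, Nat.sub_add_cancel hdepth, ← pow_succ]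
  rw [div_pow, h1, mul_pow, rpow_half_sq (by positivity)]
  calc 2 * w * (depth * W ^ depth * c ^ (depth - 1) * c) * (2 * c * (K : ℝ) ^ (-1 / (n : ℝ)) * s)
      = 4 * (w * depth * W ^ depth * (c ^ (depth - 1) * c * c) * s) * (K : ℝ) ^ (-1 / (n : ℝ)) := by
        ring
    _ ≤ 4 * (w * depth * W ^ depth * c ^ (depth + 1) * s)
          * ((K : ℝ) ^ (1 / (depth * W ^ 2) : ℝ))⁻¹ := by
        rw [hpow]; gcongr
    _ = _ := by rw [← div_eq_mul_inv]; norm_num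

end

end ClippedDNN

end

/-! ### The main theorem -/

theorem mainTheorem4
    (d D depth M K N : ℕ) (hd : 1 ≤ d) (hD : 1 ≤ D) (hdepth : 1 ≤ depth)
    (hM : 1 ≤ M) (hK : 1 ≤ K) (hN : 1 ≤ N)
    (p Lip a b u v c β : ℝ) (hp : 0 < p) (hLip : 0 ≤ Lip) (huv : u < v) (hab : a < b)
    (hc1 : 1 ≤ c) (hcu : 2 * |u| ≤ c) (hcv : 2 * |v| ≤ c) (hca : |a| ≤ c) (hcb : |b| ≤ c)
    (hcL : Lip ≤ c) (hβ : c ≤ β)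
    -- the architecture; only the entries `l 0, …, l depth` matter
    (l : ℕ → ℕ) (hl : ∀ i ≤ depth, 1 ≤ l i) (hl0 : l 0 = d) (hl1 : l depth = 1)
    (hDl : ClippedDNN.numParams l depth ≤ D)
    (NN : Set ℕ) (hNN : NN ⊆ Set.Icc 0 N) (hNN0 : 0 ∈ NN)
    {Ω : Type*} [MeasurableSpace Ω] (P : Measure Ω) [IsProbabilityMeasure P]
    -- the i.i.d. samples `(X_j, Y_j)`, `j ∈ {1, …, M}`
    (X : ℕ → Ω → (Fin d → ℝ)) (Y : ℕ → Ω → ℝ)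
    (hXm : ∀ j ∈ Set.Icc 1 M, Measurable (X j)) (hYm : ∀ j ∈ Set.Icc 1 M, Measurable (Y j))
    (hX : ∀ j ∈ Set.Icc 1 M, ∀ ω, X j ω ∈ ClippedDNN.cube d a b)
    (hY : ∀ j ∈ Set.Icc 1 M, ∀ ω, Y j ω ∈ Set.Icc u v)
    (hXYindep : iIndepFun (fun (j : Set.Icc 1 M) (ω : Ω) => (X j ω, Y j ω)) P)
    (hXYident : ∀ j ∈ Set.Icc 1 M,
      IdentDistrib (fun ω => (X j ω, Y j ω)) (fun ω => (X 1 ω, Y 1 ω)) P P)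
    -- the target function, which matters on `[a, b]^d` only
    (E : (Fin d → ℝ) → ℝ) (hE : ∀ x ∈ ClippedDNN.cube d a b, E x ∈ Set.Icc u v)
    (hEcond : (fun ω => E (X 1 ω)) =ᵐ[P] P[Y 1 | MeasurableSpace.comap (X 1) inferInstance])
    (hELip : ∀ x ∈ ClippedDNN.cube d a b, ∀ y ∈ ClippedDNN.cube d a b,
      |E x - E y| ≤ Lip * ∑ i, |x i - y i|)
    -- the random parameter vectors; `‖·‖` on `Fin D → ℝ` is the maximum norm
    (Θ : ℕ → ℕ → Ω → (Fin D → ℝ)) (hΘm : ∀ k n, Measurable (Θ k n))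
    (hΘindep : iIndepFun (fun (k : Set.Icc 1 K) => Θ k 0) P)
    (hΘident : ∀ k ∈ Set.Icc 1 K, IdentDistrib (Θ k 0) (Θ 1 0) P P)
    (hΘunif : pdf.IsUniform (Θ 1 0) (ClippedDNN.cube D (-c) c) P volume)
    (kk : Ω → ℕ × ℕ) (hkkm : Measurable kk)
    (hkk : ∀ ω, kk ω ∈ ClippedDNN.argMin
      {z : ℕ × ℕ | z.1 ∈ Set.Icc 1 K ∧ z.2 ∈ NN ∧ ‖Θ z.1 z.2 ω‖ ≤ β}
      (fun z => ClippedDNN.empiricalRisk M (ClippedDNN.scalarNet hl0 hl1 u v (Θ z.1 z.2 ω))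
        (fun j => X j ω) (fun j => Y j ω))) :
    -- the squared `L²`-error `err` and the two bounds `B₁`, `B₂`
    let err : Ω → ENNReal := fun ω =>
      ∫⁻ x in ClippedDNN.cube d a b,
        ‖ClippedDNN.scalarNet hl0 hl1 u v (Θ (kk ω).1 (kk ω).2 ω) x - E x‖ₑ ^ 2 ∂(P.map (X 1))
    let A : ℝ := ClippedDNN.archMin l depth
    let W : ℝ := (ClippedDNN.maxWidth l depth : ℝ) + 1
    let B₁ : ℝ :=
      3 * d * Lip * (b - a) / A ^ (1 / (d : ℝ))
      + 2 * ((v - u) * depth * W ^ depth * c ^ (depth + 1) * max (p / 2) 1) ^ (1 / 2 : ℝ)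
          / (K : ℝ) ^ ((2 * (depth : ℝ))⁻¹ * (W ^ 2)⁻¹)
      + max (v - u) 1
          * (10 * depth * W ^ (3 / 2 : ℝ) * max (p / 2) (Real.log (4 * M * β * c))) ^ (1 / 2 : ℝ)
          / (M : ℝ) ^ (1 / 4 : ℝ)
    let B₂ : ℝ :=
      6 * d * c ^ 2 / A ^ (1 / (d : ℝ))
      + 2 * (depth * W ^ depth * c ^ (depth + 2) * max p 1) ^ (1 / 2 : ℝ)
          / (K : ℝ) ^ ((2 * (depth : ℝ))⁻¹ * (W ^ 2)⁻¹)
      + 4 * c * β ^ (1 / 2 : ℝ) * (depth : ℝ) ^ (1 / 2 : ℝ) * W ^ (3 / 4 : ℝ)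
          * max p (Real.log (Real.exp 1 * M)) / (M : ℝ) ^ (1 / 4 : ℝ)
    Measurable err ∧
      (∫⁻ ω, err ω ^ (p / 2) ∂P) ^ (1 / p) ≤ ENNReal.ofReal B₁ ∧
      B₁ ≤ B₂ := by
  intro err A W B₁ B₂
  have h1M : 1 ∈ Set.Icc 1 M := ⟨le_rfl, hM⟩
  have hms : MeasurableSet (ClippedDNN.cube d a b) := measurableSet_Icc
  have hW1 : 1 ≤ W := by simp [W]
  have hA0 : 0 ≤ A := Nat.cast_nonneg _
  -- a measurable version of `E`
  classical
  obtain ⟨E', hE'm, hE'⟩ : ∃ E' : (Fin d → ℝ) → ℝ, Measurable E' ∧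
      ∀ x ∈ ClippedDNN.cube d a b, E' x = E x :=
    ⟨(ClippedDNN.cube d a b).piecewise E 0,
      (ClippedDNN.continuousOn_of_l1_lipschitz hLip hELip).measurable_piecewise
        continuousOn_const hms, fun x hx => Set.piecewise_eq_of_mem _ _ _ hx⟩
  have hE'b : ∀ x ∈ ClippedDNN.cube d a b, E' x ∈ Set.Icc u v := fun x hx => by
    rw [hE' x hx]; exact hE x hx
  let net (θ : Fin D → ℝ) : (Fin d → ℝ) → ℝ := ClippedDNN.scalarNet hl0 hl1 u v θ
  have hnetm (θ : Fin D → ℝ) : Measurable (net θ) :=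
    ((ClippedDNN.continuous_scalarNet hl0 hl1 u v).comp
      (continuous_const.prodMk continuous_id)).measurable
  have hnet (θ : Fin D → ℝ) (z : Fin d → ℝ) : net θ z ∈ Set.Icc u v :=
    ClippedDNN.scalarNet_mem hl0 hl1 hdepth huv.le θ z
  let T (ω : Ω) : Fin D → ℝ := Θ (kk ω).1 (kk ω).2 ω
  have hTm : Measurable T :=
    ClippedDNN.measurable_comp_countable (T := fun z : ℕ × ℕ => Θ z.1 z.2)
      (fun z => hΘm z.1 z.2) hkkm
  have herr' (ω : Ω) : err ω
      = ∫⁻ x in ClippedDNN.cube d a b, ‖net (T ω) x - E' x‖ₑ ^ 2 ∂(P.map (X 1)) :=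
    setLIntegral_congr_fun hms fun x hx => by simp only [hE' x hx, net, T]
  have hprob : IsProbabilityMeasure (P.map (X 1)) :=
    Measure.isProbabilityMeasure_map (hXm 1 h1M).aemeasurable
  have herrm : Measurable err := by
    rw [funext herr']
    exact ClippedDNN.measurable_lintegral_net hl0 hl1 u v hTm hE'm _
  let risk (θ : Fin D → ℝ) : ℝ := ∫ ω, |net θ (X 1 ω) - Y 1 ω| ^ 2 ∂P
  let emp (θ : Fin D → ℝ) (ω : Ω) : ℝ :=
    ClippedDNN.empiricalRisk M (net θ) (fun j => X j ω) (fun j => Y j ω)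
  -- The subtracted term does not depend on `θ`, so it cancels when two parameters are compared.
  have hbias (θ : Fin D → ℝ) : ∫ ω, |net θ (X 1 ω) - E' (X 1 ω)| ^ 2 ∂P
      = risk θ - ∫ ω, |E' (X 1 ω) - Y 1 ω| ^ 2 ∂P := by
    refine ClippedDNN.integral_sq_sub_condExp (hXm 1 h1M).comap_le
      (F := fun ω => net θ (X 1 ω)) (G := fun ω => E' (X 1 ω))
      ((hnetm θ).comp (comap_measurable (X 1))).stronglyMeasurable (fun _ => hnet _ _)
      ?_ (fun ω => hE'b _ (hX 1 h1M ω)) (hYm 1 h1M) (hY 1 h1M)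
    simpa only [hE' _ (hX 1 h1M _)] using hEcond
  obtain ⟨ϑ, hϑ, happ⟩ := ClippedDNN.exists_scalarNet_approx hd hl0 hl1 hdepth hl hLip hab hc1 hcu
    hcv hca hcb hcL hDl hE hELip
  set ε : ℝ := 3 * d * Lip * (b - a) / A ^ (1 / (d : ℝ)) with hε
  have hba : 0 ≤ b - a := by linarith
  have hε0 : 0 ≤ ε := by positivity
  have hrϑ : ∫ ω, |net ϑ (X 1 ω) - E' (X 1 ω)| ^ 2 ∂P ≤ ε ^ 2 := by
    have h := integral_mono_of_nonneg (μ := P)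
      (f := fun ω => |net ϑ (X 1 ω) - E' (X 1 ω)| ^ 2) (g := fun _ => ε ^ 2)
      (Filter.Eventually.of_forall fun ω => by dsimp only [Pi.zero_apply]; positivity)
      (integrable_const _) (Filter.Eventually.of_forall fun ω => by
        have := happ _ (hX 1 h1M ω)
        dsimp only
        rw [hE' _ (hX 1 h1M ω)]
        exact pow_le_pow_left₀ (abs_nonneg _) this 2)
    simpa using h
  set s : ℝ := max (p / 2) 1 with hs
  have hs1 : 1 ≤ s := le_max_right _ _
  obtain ⟨G, hGm, -, hG, hGb⟩ := ClippedDNN.exists_generalization_bound (D := D) hl0 hl1 hdepth hl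
    hM hDl huv hc1 hca hcb hβ hs1 hXm hYm hX hY hXYindep hXYident
  let Z (ω : Ω) : ℝ := (Finset.Icc 1 K).inf' (Finset.nonempty_Icc.2 hK)
    fun k => ClippedDNN.paramDist (ClippedDNN.numParams l depth) (Θ k 0 ω) ϑ
  have hn1 : 1 ≤ ClippedDNN.numParams l depth := ClippedDNN.numParams_pos hdepth (hl 1 hdepth)
  have hZb := ClippedDNN.lp_inf_paramDist_le (P := P) hn1 hDl hK (by linarith : 0 < c)
    (T := fun k => Θ k 0) (fun k => hΘm k 0) hΘindep hΘident hΘunif hϑ hs1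
  have hZm : Measurable Z := by
    convert Finset.inf'_induction (s := Finset.Icc 1 K) (Finset.nonempty_Icc.2 hK)
      (fun k ω => ClippedDNN.paramDist (ClippedDNN.numParams l depth) (Θ k 0 ω) ϑ)
      (p := Measurable) (fun _ h _ h' => h.inf h')
      fun k _ => (ClippedDNN.continuous_paramDist _ ϑ).measurable.comp (hΘm k 0) using 1
    ext ω
    simp [Z]
  set lam : ℝ := 2 * (v - u) * (depth * W ^ depth * c ^ (depth - 1) * c) with hlam
  have hvu : 0 ≤ v - u := by linarith
  have hlam0 : 0 ≤ lam := by positivity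
  -- Initializations and `ϑ` are bounded by `c`, so `lam` involves powers of `c` instead of `β`; as
  -- `c ≤ β`, the initializations are also admissible competitors of `kk ω`.
  have hae : ∀ᵐ ω ∂P, ∀ k ∈ Set.Icc 1 K, Θ k 0 ω ∈ ClippedDNN.cube D (-c) c := by
    refine (ae_ball_iff (Set.to_countable _)).2 fun k hk => ?_
    exact (hΘident k hk).symm.ae_mem_snd measurableSet_Icc
      (ClippedDNN.ae_mem_cube_of_isUniform (by linarith) hΘunif)
  -- The chain is `risk T ≤ emp T + G ≤ emp (Θ k 0) + G ≤ emp ϑ + lam * Z + G ≤ risk ϑ + lam * Z + 2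
  -- * G`, where `k` is the index of the initialization closest to `ϑ`.
  have hle : ∀ᵐ ω ∂P, err ω ≤ ENNReal.ofReal (ε ^ 2 + 2 * G ω + lam * Z ω) := by
    filter_upwards [hae] with ω hω
    rw [herr', ClippedDNN.lintegral_enorm_sq_eq (hXm 1 h1M) (hX 1 h1M) (hnetm _) hE'm (hnet _) hE'b]
    refine ENNReal.ofReal_le_ofReal ?_
    obtain ⟨⟨-, -, hTβ⟩, hmin⟩ := hkk ω
    obtain ⟨k, hk, hkZ⟩ := Finset.exists_mem_eq_inf' (Finset.nonempty_Icc.2 hK)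
      fun k => ClippedDNN.paramDist (ClippedDNN.numParams l depth) (Θ k 0 ω) ϑ
    have hk' : k ∈ Set.Icc 1 K := Finset.mem_Icc.1 hk
    have hΘc : ‖Θ k 0 ω‖ ≤ c := ClippedDNN.norm_le_of_mem_cube (by linarith) (hω k hk')
    have h1 : emp (T ω) ω ≤ emp (Θ k 0 ω) ω := hmin (k, 0) ⟨hk', hNN0, hΘc.trans hβ⟩
    have h2 : |emp (Θ k 0 ω) ω - emp ϑ ω|
        ≤ 2 * (v - u) * (depth * W ^ depth * c ^ (depth - 1) * c * Z ω) := by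
      refine ClippedDNN.abs_empiricalRisk_sub_le hM (hnet _) (hnet _) (fun j hj => hY j hj ω)
        fun j hj => ClippedDNN.abs_scalarNet_sub_scalarNet_le hl0 hl1 hc1 hc1 hΘc hϑ ?_ ?_
          (ClippedDNN.abs_le_of_mem_cube hca hcb (hX j hj ω))
      · simp only [Z, hkZ]
        exact ClippedDNN.paramDist_nonneg _ _
      · intro q hq
        simp only [Z, hkZ]
        exact ClippedDNN.abs_coord_sub_le_paramDist _ _ hq
    have h3 : |emp (T ω) ω - risk (T ω)| ≤ G ω := hG ω (T ω) hTβ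
    have h4 : |emp ϑ ω - risk ϑ| ≤ G ω := hG ω ϑ (hϑ.trans hβ)
    have h5 := hbias (T ω)
    have h6 := hbias ϑ
    have e1 : lam * Z ω = 2 * (v - u) * (depth * W ^ depth * c ^ (depth - 1) * c * Z ω) := by
      rw [hlam]; ring
    rw [e1]
    linarith [(abs_le.1 h2).2, (abs_le.1 h3).1, (abs_le.1 h4).2]
  refine ⟨herrm, ?_, ClippedDNN.first_bound_le_second_bound hM huv hab hc1 hcu hcv hca hcb hcL
    hβ hp hA0 (by linarith)⟩
  have hμ : 0 ≤ max (p / 2) (Real.log (4 * M * β * c)) := le_max_of_le_left (by linarith)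
  refine ClippedDNN.lp_error_le herrm hGm hZm hp hε0 (by positivity) ?_ hlam0 hle hs ?_ ?_
  · exact div_nonneg (mul_nonneg (by positivity) (Real.rpow_nonneg (mul_nonneg (by positivity) hμ) _))
      (by positivity)
  · refine (mul_le_mul_right hZb _).trans ?_
    rw [← ENNReal.ofReal_mul hlam0]
    refine ENNReal.ofReal_le_ofReal (ClippedDNN.optimization_bound_le hdepth hn1 hK hvu hW1
      (by linarith) (by linarith) ?_)
    simp only [W]
    exact_mod_cast ClippedDNN.numParams_le l depth
  · refine hGb.trans (ENNReal.ofReal_le_ofReal (le_of_eq ?_))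
    have hΛ := (ClippedDNN.one_le_log_four_mul hM (hc1.trans hβ) hc1).2
    -- The `1` inside `s` is irrelevant here because the logarithm is at least `1`.
    have e1 : max s (Real.log (4 * M * β * c)) = max (p / 2) (Real.log (4 * M * β * c)) := by
      rw [hs, max_assoc, max_eq_right hΛ]
    have e2 : ((M : ℝ) ^ (1 / 4 : ℝ)) ^ 2 = (M : ℝ) ^ (1 / 2 : ℝ) := by
      rw [← Real.rpow_natCast, ← Real.rpow_mul (by positivity)]; norm_num
    rw [div_pow, mul_pow, e2, e1, ClippedDNN.rpow_half_sq (mul_nonneg (by positivity) hμ)]
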